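/- Let $d\ge 1$ be an integer, let $\alpha>-\tfrac12$ and $R>0$ be real, and write points of $\mathbb{R}^{d+1}$ and $\mathbb{C}^{d+1}$ as $x=(x',x_{d+1})$. Let $\mathbb{R}^{d+1}_+=\mathbb{R}^d\times(0,\infty)$, let $d\mu_\alpha(x)=x_{d+1}^{2\alpha+1}\,dx$ on $\mathbb{R}^{d+1}_+$, and let $\mathcal{S}_*(\mathbb{R}^{d+1}_+)$ be the space of complex-valued Schwartz functions on $\mathbb{R}^{d+1}$ that are even in the last variable $x_{d+1}$ (such a function is determined by its restriction to $\mathbb{R}^{d+1}_+$). Let $$j_\alpha(z)=\Gamma(\alpha+1)\sum_{k=0}^\infty\frac{(-1)^k z^{2k}}{2^{2k}\,k!\,\Gamma(\alpha+k+1)}\qquad(z\in\mathbb{C})$$ be the normalized Bessel function and, for $\lambda,x\in\mathbb{C}^{d+1}$, let $\Lambda^d_\alpha(\lambda,x)=e^{-i\sum_{j=1}^d x_j\lambda_j}\,j_\alpha(x_{d+1}\lambda_{d+1})$. The Weinstein transform of $\varphi\in\mathcal{S}_*(\mathbb{R}^{d+1}_+)$ is $$\mathcal{F}_{W,\alpha}\varphi(\lambda)=\int_{\mathbb{R}^{d+1}_+}\varphi(x)\,\Lambda^d_\alpha(\lambda,x)\,d\mu_\alpha(x),\qquad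 \lambda\in\mathbb{R}^{d+1}_+.$$ **Theorem (Paley–Wiener).** Let $\varphi\in\mathcal{S}_*(\mathbb{R}^{d+1}_+)$. Then $\varphi$ is supported in $\{x:\|x\|<R\}$, in the sense that $\varphi(x)=0$ for every $x$ with $\|x\|\ge R$, if and only if $\mathcal{F}_{W,\alpha}\varphi$ extends to an entire function on $\mathbb{C}^{d+1}$ of exponential type $R$ in the following sense: there are an entire function $F:\mathbb{C}^{d+1}\to\mathbb{C}$ with $F(\lambda)=\mathcal{F}_{W,\alpha}\varphi(\lambda)$ for all $\lambda\in\mathbb{R}^{d+1}_+$ and a constant $c$ such that $$|F(y)|\le c\,e^{R\|\operatorname{Im}y\|}\qquad\text{for all }y\in\mathbb{C}^{d+1},$$ where $\operatorname{Im}y\in\mathbb{R}^{d+1}$ is the coordinatewise imaginary part and $\|\cdot\|$ is the Euclidean norm on $\mathbb{R}^{d+1}$. -/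

import Mathlib

open MeasureTheory
open scoped SchwartzMap

/-- The open upper half-space `ℝ^d × (0, ∞)` in `ℝ^(d+1)`; the last coordinate has
index `Fin.last d`. -/
def halfSpace (d : ℕ) : Set (EuclideanSpace ℝ (Fin (d + 1))) :=
  {x | 0 < x (Fin.last d)}

/-- The reflection `(x', t) ↦ (x', -t)` in the last variable. -/
noncomputable def reflectLast {d : ℕ} (x : EuclideanSpace ℝ (Fin (d + 1))) :
    EuclideanSpace ℝ (Fin (d + 1)) :=
  WithLp.toLp 2 (Function.update (fun i => x i) (Fin.last d) (-x (Fin.last d)))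

/-- The space `S_*` of complex-valued Schwartz functions on `ℝ^(d+1)` which are even with
respect to the last variable. -/
def EvenSchwartz (d : ℕ) : Submodule ℂ 𝓢(EuclideanSpace ℝ (Fin (d + 1)), ℂ) where
  carrier := {φ | ∀ x, φ (reflectLast x) = φ x}
  zero_mem' := fun x => by simp
  add_mem' := fun {φ ψ} hφ hψ x => by
    have h₁ := hφ x
    have h₂ := hψ x
    simp [h₁, h₂]
  smul_mem' := fun c φ hφ x => by
    have h₁ := hφ x
    simp [h₁]

/-- The measure `dμ_α(x) = x_{d+1}^(2α+1) dx` on the upper half-space. -/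
noncomputable def weinsteinMeasure (d : ℕ) (α : ℝ) :
    Measure (EuclideanSpace ℝ (Fin (d + 1))) :=
  (volume.restrict (halfSpace d)).withDensity
    (fun x => ENNReal.ofReal (x (Fin.last d) ^ (2 * α + 1)))

/-- The normalized Bessel function
`j_α(z) = Γ(α+1) ∑_k (-1)^k z^(2k) / (2^(2k) k! Γ(α+k+1))`. -/
noncomputable def normalizedBessel (α : ℝ) (z : ℂ) : ℂ :=
  (Real.Gamma (α + 1) : ℂ) *
    ∑' k : ℕ, (-1) ^ k * z ^ (2 * k) /
      (2 ^ (2 * k) * (k.factorial : ℂ) * (Real.Gamma (α + k + 1) : ℂ))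

/-- The Weinstein kernel `Λ(ξ, x) = exp(-i ⟨x', ξ'⟩) j_α(x_{d+1} ξ_{d+1})` on
`ℂ^(d+1) × ℂ^(d+1)`, with the bilinear pairing `⟨x', ξ'⟩ = ∑_{j ≤ d} x_j ξ_j`. -/
noncomputable def weinsteinKernel {d : ℕ} (α : ℝ) (ξ x : EuclideanSpace ℂ (Fin (d + 1))) : ℂ :=
  Complex.exp (-Complex.I * ∑ j : Fin d, x j.castSucc * ξ j.castSucc) *
    normalizedBessel α (x (Fin.last d) * ξ (Fin.last d))

/-- The inclusion `ℝ^n ⊆ ℂ^n`. -/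
noncomputable def complexify {n : ℕ} (x : EuclideanSpace ℝ (Fin n)) : EuclideanSpace ℂ (Fin n) :=
  WithLp.toLp 2 (fun i => (x i : ℂ))

/-- The coordinatewise imaginary part `Im y ∈ ℝ^n` of `y ∈ ℂ^n`. -/
noncomputable def imPart {n : ℕ} (y : EuclideanSpace ℂ (Fin n)) : EuclideanSpace ℝ (Fin n) :=
  WithLp.toLp 2 (fun i => (y i).im)

/-- The Weinstein transform `(F φ)(ξ) = ∫ φ(x) Λ(ξ, x) dμ_α(x)`, for real `ξ`. -/
noncomputable def weinsteinTransform {d : ℕ} (α : ℝ)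
    (φ : EuclideanSpace ℝ (Fin (d + 1)) → ℂ) (ξ : EuclideanSpace ℝ (Fin (d + 1))) : ℂ :=
  ∫ x, φ x * weinsteinKernel α (complexify ξ) (complexify x) ∂(weinsteinMeasure d α)

/-! The Weinstein transform is a Euclidean Fourier transform composed with a Weyl (Abel type)
transform in the last variable. Poisson's formula writes `j_α(r)` as a constant times the integral
of `(1 - u²)^(α - 1/2) e^{-iur}` over `|u| < 1` (`normalizedBessel_ofReal`). After rescaling and
Fubini, the transform of `φ` becomes `∫ Wφ(y) e^{-i⟨y, ξ⟩} dy`, where `Wφ(y)` integrates `φ(y', s)`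
over `s > |y_{d+1}|` (`weinsteinTransform_eq`).

If `φ` vanishes outside the ball, so does `Wφ`, since the values of `φ` entering `Wφ(y)` are taken
at points at least as far from the origin as `y`. The Fourier–Laplace integral of `Wφ` is then
entire and has the required bound.

Conversely, let `F` be an entire extension. It is given only on the open half-space, but the
Weinstein transform is smooth and even in the last variable, which forces agreement on all of
`ℝ^(d+1)` (`eq_of_contDiff_even_of_eq_pos`). For a unit vector `ω`, multiply `Wφ` by a one-sided
function of `⟪y, ω⟫ - R`. The Fourier transform of the product is a contour integral of `F` along a
complex line in direction `ω`, and it vanishes on pushing the contour into the upper half-plane.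
Hence `Wφ = 0` almost everywhere on `⟪y, ω⟫ > R` (`ae_eq_zero_of_exponentialType`).

Finally, for `‖x‖ > R` and `x_{d+1} > 0`, take `ω = x / ‖x‖`. On vertical lines `W` is a fractional
integral in `u = s²`, which is injective on half-lines (`ae_eq_zero_of_fracIntegral_eq_zero`), so `φ
x = 0`. Evenness and continuity give the remaining points. -/

/-! ### Beta integrals -/

/-- The weight `v ^ (p - 1) * (1 - v) ^ (q - 1)` on `(0, 1)`, extended by zero. -/
noncomputable def betaWeight (p q v : ℝ) : ℝ :=
  (Set.Ioo (0 : ℝ) 1).indicator (fun v => v ^ (p - 1) * (1 - v) ^ (q - 1)) v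

lemma betaWeight_eq_betaPDFReal {p q : ℝ} (hp : 0 < p) (hq : 0 < q) (v : ℝ) :
    betaWeight p q v = ProbabilityTheory.beta p q * ProbabilityTheory.betaPDFReal p q v := by
  have hb := (ProbabilityTheory.beta_pos hp hq).ne'
  by_cases h : 0 < v ∧ v < 1
  · rw [betaWeight, Set.indicator_of_mem (show v ∈ Set.Ioo (0 : ℝ) 1 from h),
      ProbabilityTheory.betaPDFReal, if_pos h]
    field_simp
  · rw [betaWeight, Set.indicator_of_notMem (show v ∉ Set.Ioo (0 : ℝ) 1 from h),
      ProbabilityTheory.betaPDFReal, if_neg h, mul_zero]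

lemma betaPDFReal_nonneg {p q : ℝ} (hp : 0 < p) (hq : 0 < q) (v : ℝ) :
    0 ≤ ProbabilityTheory.betaPDFReal p q v := by
  by_cases h : 0 < v ∧ v < 1
  · exact (ProbabilityTheory.betaPDFReal_pos h.1 h.2 hp hq).le
  · rw [ProbabilityTheory.betaPDFReal, if_neg h]

lemma integrable_betaWeight {p q : ℝ} (hp : 0 < p) (hq : 0 < q) :
    Integrable (betaWeight p q) := by
  have h : Integrable (ProbabilityTheory.betaPDFReal p q) := by
    refine ⟨(ProbabilityTheory.measurable_betaPDFReal p q).aestronglyMeasurable, ?_⟩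
    rw [hasFiniteIntegral_iff_ofReal (Filter.Eventually.of_forall (betaPDFReal_nonneg hp hq))]
    have := ProbabilityTheory.lintegral_betaPDF_eq_one hp hq
    unfold ProbabilityTheory.betaPDF at this
    rw [this]; exact ENNReal.one_lt_top
  rw [funext (betaWeight_eq_betaPDFReal hp hq)]
  exact h.const_mul _

lemma integral_betaWeight {p q : ℝ} (hp : 0 < p) (hq : 0 < q) :
    ∫ v, betaWeight p q v = ProbabilityTheory.beta p q := by
  have h : ∫ v, ProbabilityTheory.betaPDFReal p q v = 1 := by
    rw [integral_eq_lintegral_of_nonneg_ae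
      (Filter.Eventually.of_forall (betaPDFReal_nonneg hp hq))
      (ProbabilityTheory.measurable_betaPDFReal p q).aestronglyMeasurable]
    have := ProbabilityTheory.lintegral_betaPDF_eq_one hp hq
    unfold ProbabilityTheory.betaPDF at this
    rw [this]; rfl
  rw [funext (betaWeight_eq_betaPDFReal hp hq), integral_const_mul, h, mul_one]

/-! ### The Abel kernel, its moments and its scaling -/

/-- The Abel kernel `(s² - t²) ^ (a - 1/2)` on `|t| < s`, extended by zero. -/
noncomputable def abelKernel (a s t : ℝ) : ℝ :=
  if |t| < s then (s ^ 2 - t ^ 2) ^ (a - 1 / 2) else 0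

lemma abelKernel_nonneg (a s t : ℝ) : 0 ≤ abelKernel a s t := by
  unfold abelKernel
  split_ifs with h
  · exact Real.rpow_nonneg (by nlinarith [sq_abs t, abs_nonneg t]) _
  · exact le_rfl

lemma abelKernel_neg (a s t : ℝ) : abelKernel a s (-t) = abelKernel a s t := by
  simp [abelKernel]

lemma abelKernel_abs (a s t : ℝ) : abelKernel a s |t| = abelKernel a s t := by
  simp [abelKernel]

lemma measurable_abelKernel (a : ℝ) : Measurable (fun p : ℝ × ℝ => abelKernel a p.1 p.2) := by
  unfold abelKernel
  exact Measurable.ite (measurableSet_lt (by fun_prop) (by fun_prop)) (by fun_prop) (by fun_prop)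

lemma measurable_abelKernel_right (a s : ℝ) : Measurable (abelKernel a s) :=
  (measurable_abelKernel a).comp (measurable_const.prodMk measurable_id)

lemma abelKernel_mul {a s : ℝ} (hs : 0 < s) (u : ℝ) :
    abelKernel a s (s * u) = s ^ (2 * a - 1) * abelKernel a 1 u := by
  unfold abelKernel
  have h1 : |s * u| < s ↔ |u| < 1 := by
    rw [abs_mul, abs_of_pos hs]
    constructor <;> intro h <;> nlinarith
  by_cases h : |u| < 1
  · rw [if_pos (h1.2 h), if_pos h]
    have h2 : 0 ≤ 1 - u ^ 2 := by nlinarith [sq_abs u, abs_nonneg u]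
    rw [show s ^ 2 - (s * u) ^ 2 = s ^ 2 * (1 ^ 2 - u ^ 2) by ring,
      Real.mul_rpow (by positivity) (by linarith), ← Real.rpow_natCast s 2,
      ← Real.rpow_mul hs.le]
    congr 2; push_cast; ring
  · rw [if_neg (fun h' => h (h1.1 h')), if_neg h, mul_zero]

/-- The even moments of `abelKernel a 1` are Beta integrals. -/
lemma two_mul_pow_mul_abelKernel {a x : ℝ} (k : ℕ) (hx : 0 < x) :
    2 * (x ^ (2 * k) * abelKernel a 1 x) =
      (2 * x ^ ((2 : ℝ) - 1)) • betaWeight (k + 1 / 2) (a + 1 / 2) (x ^ (2 : ℝ)) := by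
  have e : (2 : ℝ) - 1 = 1 := by norm_num
  rw [e, Real.rpow_one, Real.rpow_two, smul_eq_mul]
  by_cases h : x < 1
  · have h2 : x ^ 2 ∈ Set.Ioo (0 : ℝ) 1 := ⟨by positivity, by nlinarith⟩
    rw [betaWeight, Set.indicator_of_mem h2, abelKernel, if_pos (by rwa [abs_of_pos hx]), one_pow]
    rw [show a + 1 / 2 - 1 = a - 1 / 2 by ring]
    have h3 : (x ^ 2) ^ ((k : ℝ) + 1 / 2 - 1) * x = x ^ (2 * k) := by
      rw [← Real.rpow_natCast x 2, ← Real.rpow_mul hx.le, ← Real.rpow_natCast x (2 * k)]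
      nth_rewrite 2 [← Real.rpow_one x]
      rw [← Real.rpow_add hx]
      congr 1; push_cast; ring
    rw [← h3]; ring
  · have h2 : x ^ 2 ∉ Set.Ioo (0 : ℝ) 1 := fun h' => h (by nlinarith [h'.2])
    rw [betaWeight, Set.indicator_of_notMem h2, abelKernel,
      if_neg (by rwa [abs_of_pos hx])]
    simp

lemma integrable_abelKernel_one {a : ℝ} (ha : -(1 / 2 : ℝ) < a) :
    Integrable (abelKernel a 1) := by
  have h1 : IntegrableOn (abelKernel a 1) (Set.Ioi 0) := by
    have := (integrableOn_Ioi_comp_rpow_iff (betaWeight ((0 : ℕ) + 1 / 2) (a + 1 / 2))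
      (two_ne_zero (α := ℝ))).2
      (integrable_betaWeight (by norm_num) (by linarith)).integrableOn
    rw [abs_of_pos (two_pos (α := ℝ))] at this
    have h2 := (this.congr_fun (fun x hx => (two_mul_pow_mul_abelKernel (a := a) 0 hx).symm)
      measurableSet_Ioi).const_mul (1 / 2)
    refine h2.congr (Filter.Eventually.of_forall fun x => ?_)
    simp
  have h2 : IntegrableOn (abelKernel a 1) (Set.Iic 0) := by
    rw [← integrableOn_Ici_iff_integrableOn_Ioi] at h1
    have := h1.comp_neg
    simpa [abelKernel_neg] using this
  rw [← integrableOn_univ, ← Set.Iic_union_Ioi (a := (0 : ℝ))]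
  exact h2.union h1

lemma integral_pow_mul_abelKernel_one {a : ℝ} (ha : -(1 / 2 : ℝ) < a) (k : ℕ) :
    ∫ u, u ^ (2 * k) * abelKernel a 1 u = ProbabilityTheory.beta (k + 1 / 2) (a + 1 / 2) := by
  have h1 : ∀ u : ℝ, u ^ (2 * k) * abelKernel a 1 u = |u| ^ (2 * k) * abelKernel a 1 |u| := by
    intro u
    rw [abelKernel_abs, pow_mul, pow_mul, sq_abs]
  rw [funext h1, integral_comp_abs (f := fun u => u ^ (2 * k) * abelKernel a 1 u),
    ← integral_const_mul,
    setIntegral_congr_fun measurableSet_Ioi (fun x hx => two_mul_pow_mul_abelKernel k hx),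
    integral_comp_rpow_Ioi_of_pos two_pos, setIntegral_eq_integral_of_forall_compl_eq_zero,
    integral_betaWeight (by positivity) (by linarith)]
  intro x hx
  rw [betaWeight, Set.indicator_of_notMem]
  exact fun h => hx h.1

lemma integral_comp_mul_abelKernel {a s : ℝ} (hs : 0 < s) (g : ℝ → ℂ) :
    ∫ t, (abelKernel a s t : ℂ) * g t =
      (s ^ (2 * a) : ℝ) * ∫ u, (abelKernel a 1 u : ℂ) * g (s * u) := by
  have h := Measure.integral_comp_mul_left (fun t => (abelKernel a s t : ℂ) * g t) s
  rw [abs_of_pos (inv_pos.2 hs)] at h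
  have h2 : ∫ t, (abelKernel a s t : ℂ) * g t =
      s • ∫ u, (abelKernel a s (s * u) : ℂ) * g (s * u) := by
    rw [h, smul_smul, mul_inv_cancel₀ hs.ne', one_smul]
  rw [h2, Complex.real_smul]
  simp_rw [abelKernel_mul hs, Complex.ofReal_mul, mul_assoc]
  rw [integral_const_mul, ← mul_assoc, ← Complex.ofReal_mul]
  congr 2
  nth_rewrite 1 [← Real.rpow_one s]
  rw [← Real.rpow_add hs]; congr 1; ring

lemma integrable_abelKernel {a : ℝ} (ha : -(1 / 2 : ℝ) < a) (s : ℝ) :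
    Integrable (abelKernel a s) := by
  rcases le_or_gt s 0 with hs | hs
  · have : abelKernel a s = fun _ => 0 := by
      ext t; rw [abelKernel, if_neg (by linarith [abs_nonneg t])]
    rw [this]; exact integrable_zero _ _ _
  · rw [← integrable_comp_mul_left_iff (abelKernel a s) hs.ne']
    simp_rw [abelKernel_mul hs]
    exact (integrable_abelKernel_one ha).const_mul _

lemma integral_abelKernel {a s : ℝ} (ha : -(1 / 2 : ℝ) < a) (hs : 0 < s) :
    ∫ t, abelKernel a s t = s ^ (2 * a) * ProbabilityTheory.beta (1 / 2) (a + 1 / 2) := by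
  have h := integral_comp_mul_abelKernel (a := a) hs (fun _ => 1)
  have h1 := integral_pow_mul_abelKernel_one ha 0
  simp only [mul_zero, pow_zero, one_mul, Nat.cast_zero, zero_add] at h1
  simp only [mul_one, integral_complex_ofReal, h1] at h
  exact_mod_cast h

/-! ### Poisson's integral for the normalized Bessel function -/

/-- The constant of the Poisson integral representation of the normalized Bessel function. -/
noncomputable def poissonConst (a : ℝ) : ℝ :=
  Real.Gamma (a + 1) / (√Real.pi * Real.Gamma (a + 1 / 2))

lemma poissonConst_pos {a : ℝ} (ha : -(1 / 2 : ℝ) < a) : 0 < poissonConst a := by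
  have h1 : 0 < Real.Gamma (a + 1) := Real.Gamma_pos_of_pos (by linarith)
  have h2 : 0 < Real.Gamma (a + 1 / 2) := Real.Gamma_pos_of_pos (by linarith)
  unfold poissonConst
  positivity

/-- Legendre duplication at `k + 1/2`. It trades the Bessel denominators for the `(2k)!` of the
cosine series. -/
lemma gamma_nat_add_half_mul_factorial (k : ℕ) :
    Real.Gamma (k + 1 / 2) * (k.factorial : ℝ) * 2 ^ (2 * k) =
      ((2 * k).factorial : ℝ) * √Real.pi := by
  have h := Real.Gamma_mul_Gamma_add_half (k + 1 / 2)
  rw [show (k : ℝ) + 1 / 2 + 1 / 2 = k + 1 by ring, Real.Gamma_nat_eq_factorial,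
    show 2 * ((k : ℝ) + 1 / 2) = ((2 * k : ℕ) : ℝ) + 1 by push_cast; ring,
    Real.Gamma_nat_eq_factorial,
    show 1 - (((2 * k : ℕ) : ℝ) + 1) = -((2 * k : ℕ) : ℝ) by ring,
    Real.rpow_neg two_pos.le, Real.rpow_natCast] at h
  rw [h]
  field_simp

/-- Evenness of the kernel replaces the exponential by a cosine, whose power series is integrated
termwise using the Beta moments. Real arguments suffice, because the extension to complex
frequencies is made on the Fourier side. -/
lemma normalizedBessel_ofReal {a : ℝ} (ha : -(1 / 2 : ℝ) < a) (r : ℝ) :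
    normalizedBessel a r =
      (poissonConst a : ℂ) * ∫ u, (abelKernel a 1 u : ℂ) * Complex.exp (-(u * r : ℝ) * Complex.I) := by
  have hW := integrable_abelKernel_one ha
  have hb : ∀ u, u ∉ Set.Ioo (-1 : ℝ) 1 → abelKernel a 1 u = 0 := by
    intro u hu
    rw [abelKernel, if_neg]
    rwa [abs_lt]
  have hexp : ∀ c : ℂ, c.re = 0 → Integrable
      (fun u : ℝ => (abelKernel a 1 u : ℂ) * Complex.exp ((u * r : ℝ) * c)) := by
    intro c hc
    refine hW.ofReal.mul_bdd (c := 1) (by fun_prop) (Filter.Eventually.of_forall fun u => ?_)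
    rw [Complex.norm_exp]
    simp [hc]
  have hcos : ∫ u, (abelKernel a 1 u : ℂ) * Complex.exp (-(u * r : ℝ) * Complex.I) =
      ∫ u, (abelKernel a 1 u : ℂ) * Complex.cos (u * r : ℝ) := by
    have h1 := hexp Complex.I (by simp)
    have h2 := hexp (-Complex.I) (by simp)
    have h3 : ∫ u, (abelKernel a 1 u : ℂ) * Complex.exp ((u * r : ℝ) * Complex.I) =
        ∫ u, (abelKernel a 1 u : ℂ) * Complex.exp ((u * r : ℝ) * -Complex.I) := by
      rw [← integral_neg_eq_self]
      simp [abelKernel_neg]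
    simp_rw [Complex.cos]
    have h4 : ∀ u : ℝ, (abelKernel a 1 u : ℂ) * ((Complex.exp ((u * r : ℝ) * Complex.I) +
        Complex.exp (-(u * r : ℝ) * Complex.I)) / 2) = (1 / 2) *
        ((abelKernel a 1 u : ℂ) * Complex.exp ((u * r : ℝ) * Complex.I) +
        (abelKernel a 1 u : ℂ) * Complex.exp ((u * r : ℝ) * -Complex.I)) := by
      intro u
      rw [mul_neg, ← neg_mul]; ring
    simp_rw [h4]
    rw [integral_const_mul, integral_add h1 h2, h3]
    simp_rw [mul_neg, ← neg_mul]
    ring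
  set G : ℕ → ℝ → ℂ := fun k u =>
    (((-1) ^ k * r ^ (2 * k) / (2 * k).factorial * (u ^ (2 * k) * abelKernel a 1 u) : ℝ) : ℂ)
    with hG
  have hGi' : ∀ k : ℕ, Integrable (fun u => u ^ (2 * k) * abelKernel a 1 u) := by
    intro k
    refine hW.mono ((by fun_prop : Measurable fun u : ℝ => u ^ (2 * k)).mul
      (measurable_abelKernel_right a 1)).aestronglyMeasurable
      (Filter.Eventually.of_forall fun u => ?_)
    by_cases hu : u ∈ Set.Ioo (-1 : ℝ) 1
    · rw [norm_mul, norm_pow]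
      refine mul_le_of_le_one_left (norm_nonneg _) (pow_le_one₀ (norm_nonneg _) ?_)
      rw [Real.norm_eq_abs, abs_le]; exact ⟨hu.1.le, hu.2.le⟩
    · simp [hb u hu]
  have hGi : ∀ k, Integrable (G k) := fun k => ((hGi' k).const_mul _).ofReal
  have hGint : ∀ k, ∫ u, G k u = (((-1) ^ k * r ^ (2 * k) / (2 * k).factorial *
      ProbabilityTheory.beta (k + 1 / 2) (a + 1 / 2) : ℝ) : ℂ) := by
    intro k
    rw [hG, integral_complex_ofReal, integral_const_mul, integral_pow_mul_abelKernel_one ha]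
  have hsum : Summable fun k => ∫ u, ‖G k u‖ := by
    have h1 : Summable fun k : ℕ => |r| ^ (2 * k) / ((2 * k).factorial : ℝ) *
        ∫ u, abelKernel a 1 u := by
      refine Summable.mul_right _ ?_
      exact (Real.summable_pow_div_factorial |r|).comp_injective
        (fun m n (h : 2 * m = 2 * n) => by omega)
    refine h1.of_nonneg_of_le (fun k => integral_nonneg fun u => norm_nonneg _) (fun k => ?_)
    rw [← integral_const_mul]
    refine integral_mono (hGi k).norm (hW.const_mul _) (fun u => ?_)
    simp only [hG, Complex.norm_real, norm_mul, norm_div, norm_pow, norm_neg, norm_one, one_pow,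
      one_mul, Real.norm_eq_abs, Nat.abs_cast]
    refine mul_le_mul_of_nonneg_left ?_ (by positivity)
    rw [abs_of_nonneg (abelKernel_nonneg _ _ _)]
    by_cases hu : u ∈ Set.Ioo (-1 : ℝ) 1
    · refine mul_le_of_le_one_left (abelKernel_nonneg _ _ _) (pow_le_one₀ (abs_nonneg _) ?_)
      rw [abs_le]; exact ⟨hu.1.le, hu.2.le⟩
    · simp [hb u hu]
  have hmain := integral_tsum_of_summable_integral_norm hGi hsum
  have hpt : ∀ u, ∑' k, G k u = (abelKernel a 1 u : ℂ) * Complex.cos (u * r : ℝ) := by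
    intro u
    have := ((Complex.hasSum_cos ((u * r : ℝ) : ℂ)).mul_left (abelKernel a 1 u : ℂ)).tsum_eq
    rw [← this]
    refine tsum_congr fun k => ?_
    simp only [hG]; push_cast; ring
  rw [hcos, ← integral_congr_ae (Filter.Eventually.of_forall hpt), ← hmain, normalizedBessel,
    ← tsum_mul_left, ← tsum_mul_left]
  refine tsum_congr fun k => ?_
  rw [hGint]
  have hk := gamma_nat_add_half_mul_factorial k
  have g1 : Real.Gamma (a + 1 / 2) ≠ 0 := (Real.Gamma_pos_of_pos (by linarith)).ne'
  have g2 : Real.Gamma (a + k + 1) ≠ 0 :=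
    (Real.Gamma_pos_of_pos (by have : (0 : ℝ) ≤ k := by positivity
                               linarith)).ne'
  have g3 : √Real.pi ≠ 0 := by positivity
  have hreal : Real.Gamma (a + 1) * ((-1) ^ k * r ^ (2 * k) /
      (2 ^ (2 * k) * (k.factorial : ℝ) * Real.Gamma (a + k + 1))) =
      poissonConst a * ((-1) ^ k * r ^ (2 * k) / (2 * k).factorial *
      ProbabilityTheory.beta (k + 1 / 2) (a + 1 / 2)) := by
    rw [ProbabilityTheory.beta, poissonConst,
      show (k : ℝ) + 1 / 2 + (a + 1 / 2) = a + k + 1 by ring]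
    have h5 : ((2 * k).factorial : ℝ) ≠ 0 := by positivity
    have h6 : (k.factorial : ℝ) ≠ 0 := by positivity
    have h7 : Real.Gamma (k + 1 / 2) = ((2 * k).factorial : ℝ) * √Real.pi /
        ((k.factorial : ℝ) * 2 ^ (2 * k)) := by
      rw [← hk]; field_simp
    rw [h7]
    generalize Real.Gamma (a + 1 / 2) = g at g1 ⊢
    generalize Real.Gamma (a + k + 1) = g' at g2 ⊢
    field_simp
  exact_mod_cast congrArg (fun x : ℝ => (x : ℂ)) hreal

/-! ### Fractional integrals: semigroup law and injectivity -/

/-- The kernel `(u - v) ^ (b - 1)` on `v < u` of the fractional integral of order `b`. -/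
noncomputable def fracKernel (b v u : ℝ) : ℝ :=
  if v < u then (u - v) ^ (b - 1) else 0

/-- The (unnormalized) fractional integral `∫_v^∞ (u - v) ^ (b - 1) g(u) du`. -/
noncomputable def fracIntegral (b : ℝ) (g : ℝ → ℂ) (v : ℝ) : ℂ :=
  ∫ u, (fracKernel b v u : ℂ) * g u

lemma fracKernel_nonneg (b v u : ℝ) : 0 ≤ fracKernel b v u := by
  unfold fracKernel
  split_ifs with h
  · exact Real.rpow_nonneg (by linarith) _
  · exact le_rfl

lemma measurable_fracKernel (b : ℝ) :
    Measurable (fun p : ℝ × ℝ => fracKernel b p.1 p.2) := by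
  unfold fracKernel
  exact Measurable.ite (measurableSet_lt (by fun_prop) (by fun_prop)) (by fun_prop) (by fun_prop)

/-- The affine map `v ↦ (v - w) / (u - w)` carries `w < v < u` onto `(0, 1)`, so that integration in
`v` produces a Beta integral. This is the source of the semigroup law. -/
lemma fracKernel_mul_fracKernel {c b w u : ℝ} (h : w < u) (v : ℝ) :
    fracKernel c w v * fracKernel b v u =
      (u - w) ^ (c + b - 2) * betaWeight c b ((v - w) / (u - w)) := by
  have hd : 0 < u - w := by linarith
  by_cases hv : w < v ∧ v < u
  · have hm : (v - w) / (u - w) ∈ Set.Ioo (0 : ℝ) 1 :=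
      ⟨div_pos (by linarith) hd, by rw [div_lt_one hd]; linarith⟩
    rw [fracKernel, fracKernel, if_pos hv.1, if_pos hv.2, betaWeight, Set.indicator_of_mem hm,
      show 1 - (v - w) / (u - w) = (u - v) / (u - w) by field_simp; ring,
      Real.div_rpow (by linarith [hv.1]) hd.le, Real.div_rpow (by linarith [hv.2]) hd.le,
      show c + b - 2 = (c - 1) + (b - 1) by ring, Real.rpow_add hd]
    have h1 := (Real.rpow_pos_of_pos hd (c - 1)).ne'
    have h2 := (Real.rpow_pos_of_pos hd (b - 1)).ne'
    field_simp
  · have hm : (v - w) / (u - w) ∉ Set.Ioo (0 : ℝ) 1 := by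
      rintro ⟨h1, h2⟩
      rw [div_lt_one hd] at h2
      have := (div_pos_iff_of_pos_right hd).1 h1
      exact hv ⟨by linarith, by linarith⟩
    rw [betaWeight, Set.indicator_of_notMem hm, mul_zero]
    by_cases h1 : w < v
    · rw [fracKernel, fracKernel, if_neg (fun h2 : v < u => hv ⟨h1, h2⟩), mul_zero]
    · rw [fracKernel, if_neg h1, zero_mul]

lemma fracKernel_mul_fracKernel_of_le {c b w u : ℝ} (h : u ≤ w) (v : ℝ) :
    fracKernel c w v * fracKernel b v u = 0 := by
  by_cases h1 : w < v
  · rw [fracKernel, fracKernel, if_neg (by linarith : ¬ v < u), mul_zero]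
  · rw [fracKernel, if_neg h1, zero_mul]

lemma integrable_fracKernel_mul_fracKernel {c b : ℝ} (hc : 0 < c) (hb : 0 < b) (w u : ℝ) :
    Integrable (fun v => fracKernel c w v * fracKernel b v u) := by
  rcases le_or_gt u w with h | h
  · simp_rw [fracKernel_mul_fracKernel_of_le h]
    exact integrable_zero _ _ _
  · simp_rw [fracKernel_mul_fracKernel h]
    refine Integrable.const_mul ?_ _
    exact ((integrable_betaWeight hc hb).comp_div (by linarith : u - w ≠ 0)).comp_sub_right w

lemma integral_fracKernel_mul_fracKernel {c b : ℝ} (hc : 0 < c) (hb : 0 < b) (w u : ℝ) :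
    ∫ v, fracKernel c w v * fracKernel b v u =
      ProbabilityTheory.beta c b * fracKernel (c + b) w u := by
  rcases le_or_gt u w with h | h
  · simp_rw [fracKernel_mul_fracKernel_of_le h]
    rw [fracKernel, if_neg (by linarith)]
    simp
  · have hd : 0 < u - w := by linarith
    simp_rw [fracKernel_mul_fracKernel h]
    rw [integral_const_mul,
      integral_sub_right_eq_self (fun v => betaWeight c b (v / (u - w))) w,
      Measure.integral_comp_div, integral_betaWeight hc hb, fracKernel, if_pos h,
      abs_of_pos hd, smul_eq_mul, ← mul_assoc, mul_comm (ProbabilityTheory.beta c b)]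
    congr 1
    nth_rewrite 2 [← Real.rpow_one (u - w)]
    rw [← Real.rpow_add hd]; congr 1; ring

/-- The semigroup property of fractional integrals. -/
lemma fracIntegral_fracIntegral {c b : ℝ} (hc : 0 < c) (hb : 0 < b) {g : ℝ → ℂ}
    (hg : Measurable g) {w : ℝ}
    (hint : Integrable (fun u => (fracKernel (c + b) w u : ℂ) * g u)) :
    Integrable (fun v => (fracKernel c w v : ℂ) * fracIntegral b g v) ∧
      fracIntegral c (fracIntegral b g) w =
        (ProbabilityTheory.beta c b : ℂ) * fracIntegral (c + b) g w := by
  set Φ : ℝ × ℝ → ℂ := fun p => ((fracKernel c w p.1 * fracKernel b p.1 p.2 : ℝ) : ℂ) * g p.2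
    with hΦ
  have hmeas : Measurable Φ := by
    refine (Complex.measurable_ofReal.comp (Measurable.mul ?_ (measurable_fracKernel b))).mul
      (hg.comp measurable_snd)
    exact (measurable_fracKernel c).comp (measurable_const.prodMk measurable_fst)
  have hΦi : Integrable Φ (volume.prod volume) := by
    -- Integrating in `v` first collapses the two kernels into one of order `c + b`, where `hint`
    -- applies.
    rw [integrable_prod_iff' hmeas.aestronglyMeasurable]
    refine ⟨Filter.Eventually.of_forall fun u => ?_, ?_⟩
    · have h1 : Integrable fun v => ((fracKernel c w v * fracKernel b v u : ℝ) : ℂ) :=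
        (integrable_fracKernel_mul_fracKernel hc hb w u).ofReal
      exact h1.mul_const (g u)
    · have : ∀ u, ∫ v, ‖Φ (v, u)‖ =
          ProbabilityTheory.beta c b * ‖(fracKernel (c + b) w u : ℂ) * g u‖ := by
        intro u
        simp only [hΦ, norm_mul, Complex.norm_real, Real.norm_eq_abs,
          abs_of_nonneg (fracKernel_nonneg _ _ _)]
        rw [integral_mul_const, integral_fracKernel_mul_fracKernel hc hb, mul_assoc]
      simp_rw [this]
      exact hint.norm.const_mul _
  have hinner : ∀ v, ∫ u, Φ (v, u) = (fracKernel c w v : ℂ) * fracIntegral b g v := by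
    intro v
    simp only [hΦ, fracIntegral]
    rw [← integral_const_mul]
    congr 1; ext u; push_cast; ring
  refine ⟨by simpa only [hinner] using hΦi.integral_prod_left, ?_⟩
  have h1 := integral_integral_swap (f := fun v u => Φ (v, u)) hΦi
  simp only [hinner] at h1
  rw [fracIntegral, h1, fracIntegral, ← integral_const_mul]
  congr 1; ext u
  simp only [hΦ]
  rw [integral_mul_const, integral_complex_ofReal, integral_fracKernel_mul_fracKernel hc hb]
  push_cast; ring

lemma fracKernel_one_mul (w : ℝ) (h : ℝ → ℂ) :
    (fun v => (fracKernel 1 w v : ℂ) * h v) = (Set.Ioi w).indicator h := by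
  ext v
  by_cases hv : w < v
  · rw [Set.indicator_of_mem (show v ∈ Set.Ioi w from hv), fracKernel, if_pos hv]; simp
  · rw [Set.indicator_of_notMem (show v ∉ Set.Ioi w from hv), fracKernel, if_neg hv]; simp

/-- Vanishing tails make the primitive of `h` almost everywhere constant on the half-line, hence
constant there by continuity; Lebesgue differentiation then gives `h = 0`. -/
lemma ae_eq_zero_of_fracIntegral_one_eq_zero {h : ℝ → ℂ} {v₀ : ℝ}
    (hi : Integrable (fun v => (fracKernel 1 v₀ v : ℂ) * h v))
    (h0 : ∀ᵐ w, v₀ < w → fracIntegral 1 h w = 0) : ∀ᵐ v, v₀ < v → h v = 0 := by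
  rw [fracKernel_one_mul] at hi
  set H := (Set.Ioi v₀).indicator h with hH
  have hon : IntegrableOn h (Set.Ioi v₀) := (integrable_indicator_iff measurableSet_Ioi).1 hi
  have hprim : Continuous fun w => ∫ t in v₀..w, H t :=
    intervalIntegral.continuous_primitive (fun _ _ => hi.intervalIntegrable) v₀
  have hae : (fun w => ∫ t in v₀..w, H t) =ᵐ[volume.restrict (Set.Ioi v₀)]
      fun _ => ∫ t in Set.Ioi v₀, h t := by
    rw [Filter.EventuallyEq, ae_restrict_iff' measurableSet_Ioi]
    filter_upwards [h0] with w hw hlt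
    have hlt' : v₀ < w := hlt
    have hw1 : ∫ v in Set.Ioi w, h v = 0 := by
      have := hw hlt'
      rwa [fracIntegral, fracKernel_one_mul, integral_indicator measurableSet_Ioi] at this
    have h3 := setIntegral_union (μ := volume) (f := h) (s := Set.Ioc v₀ w) (t := Set.Ioi w)
      (Set.Ioc_disjoint_Ioi le_rfl) measurableSet_Ioi (hon.mono_set Set.Ioc_subset_Ioi_self)
      (hon.mono_set (Set.Ioi_subset_Ioi hlt'.le))
    rw [Set.Ioc_union_Ioi_eq_Ioi hlt'.le, hw1, add_zero] at h3
    rw [intervalIntegral.integral_of_le hlt'.le, h3]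
    refine setIntegral_congr_fun measurableSet_Ioc fun t ht => ?_
    exact Set.indicator_of_mem (show t ∈ Set.Ioi v₀ from ht.1) h
  have heq := Measure.eqOn_open_of_ae_eq hae isOpen_Ioi hprim.continuousOn continuousOn_const
  filter_upwards [LocallyIntegrable.ae_hasDerivAt_integral hi.locallyIntegrable] with v hv hlt
  have hd := hv v₀
  rw [hH, Set.indicator_of_mem (show v ∈ Set.Ioi v₀ from hlt), ← hH] at hd
  refine hd.unique ((hasDerivAt_const v (∫ t in Set.Ioi v₀, h t)).congr_of_eventuallyEq ?_)
  filter_upwards [Ioi_mem_nhds hlt] with x hx using heq hx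

/-- Injectivity of the fractional integral on a half-line. -/
lemma ae_eq_zero_of_fracIntegral_eq_zero {b : ℝ} (hb : 0 < b) {g : ℝ → ℂ} (hg : Measurable g)
    {v₀ : ℝ}
    (hint : ∀ p > 0, ∀ w ≥ v₀, Integrable (fun u => (fracKernel p w u : ℂ) * g u))
    (h0 : ∀ᵐ v, v₀ < v → fracIntegral b g v = 0) : ∀ᵐ u, v₀ < u → g u = 0 := by
  -- For integer orders, order `n + 2` is order `1` applied to order `n + 1`, so the order can be
  -- lowered one step at a time.
  have key : ∀ n : ℕ, (∀ᵐ w, v₀ < w → fracIntegral (n + 1 : ℕ) g w = 0) →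
      ∀ᵐ u, v₀ < u → g u = 0 := by
    intro n
    induction n with
    | zero =>
      intro h
      simp only [zero_add, Nat.cast_one] at h
      exact ae_eq_zero_of_fracIntegral_one_eq_zero (hint 1 one_pos v₀ le_rfl) h
    | succ n ih =>
      intro h
      have hn : (0 : ℝ) < ((n + 1 : ℕ) : ℝ) := by positivity
      have hsg : ∀ w ≥ v₀, _ := fun w hw => fracIntegral_fracIntegral one_pos hn hg
        (hint (1 + ((n + 1 : ℕ) : ℝ)) (by positivity) w hw)
      refine ih (ae_eq_zero_of_fracIntegral_one_eq_zero (hsg v₀ le_rfl).1 ?_)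
      filter_upwards [h] with w hw hlt
      rw [(hsg w hlt.le).2, show (1 : ℝ) + ((n + 1 : ℕ) : ℝ) = ((n + 1 + 1 : ℕ) : ℝ) by
          push_cast; ring, hw hlt, mul_zero]
  -- A further fractional integral of order `n + 1 - b > 0` lifts the hypothesis from order `b` to
  -- the integer order `n + 1`.
  obtain ⟨n, hn⟩ := exists_nat_gt b
  refine key n (Filter.Eventually.of_forall fun w hw => ?_)
  have hc : 0 < ((n + 1 : ℕ) : ℝ) - b := by push_cast; linarith
  have hsg := fracIntegral_fracIntegral hc hb hg
    (hint ((((n + 1 : ℕ) : ℝ) - b) + b) (by linarith) w hw.le)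
  have hz : fracIntegral (((n + 1 : ℕ) : ℝ) - b) (fracIntegral b g) w = 0 := by
    rw [fracIntegral]
    refine integral_eq_zero_of_ae ?_
    filter_upwards [h0] with v hv
    by_cases h : w < v
    · rw [hv (hw.trans h), mul_zero]; rfl
    · rw [fracKernel, if_neg h]; simp
  rw [hz, sub_add_cancel] at hsg
  have hB : (ProbabilityTheory.beta (((n + 1 : ℕ) : ℝ) - b) b : ℂ) ≠ 0 := by
    exact_mod_cast (ProbabilityTheory.beta_pos hc hb).ne'
  exact (mul_eq_zero.1 hsg.2.symm).resolve_left hB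

/-! ### Injectivity of the Fourier transform on integrable functions -/

open scoped FourierTransform in
/-- The Fourier transform is injective on integrable functions. -/
lemma ae_eq_zero_of_fourier_eq_zero {V : Type*} [NormedAddCommGroup V] [InnerProductSpace ℝ V]
    [FiniteDimensional ℝ V] [MeasurableSpace V] [BorelSpace V] {f : V → ℂ} (hf : Integrable f)
    (h : ∀ ξ, 𝓕 f ξ = 0) : ∀ᵐ x, f x = 0 := by
  refine ae_eq_zero_of_integral_contDiff_smul_eq_zero hf.locallyIntegrable fun g hg hgs => ?_
  have hgs' : HasCompactSupport (fun x => (g x : ℂ)) := hgs.comp_left Complex.ofReal_zero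
  set G : 𝓢(V, ℂ) := hgs'.toSchwartzMap (Complex.ofRealCLM.contDiff.comp hg) with hG
  set ψ : 𝓢(V, ℂ) := 𝓕⁻ G with hψ
  have h1 : 𝓕 ψ = G := by rw [hψ, FourierTransform.fourier_fourierInv_eq]
  have h2 : ∀ x, 𝓕 (ψ : V → ℂ) x = (g x : ℂ) := by
    intro x
    rw [← SchwartzMap.fourier_coe, h1]
    rfl
  -- The multiplication formula moves the transform from `f` to `ψ`, whose transform is the test
  -- function `g`.
  have h3 := VectorFourier.integral_fourierIntegral_smul_eq_flip (μ := volume) (ν := volume)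
    (L := innerₗ V) (f := f) (g := (ψ : V → ℂ)) Real.continuous_fourierChar continuous_inner hf
    ψ.integrable
  rw [flip_innerₗ] at h3
  change ∫ ξ, 𝓕 f ξ • ψ ξ = ∫ x, f x • 𝓕 (ψ : V → ℂ) x at h3
  simp only [h, h2, zero_smul, integral_zero] at h3
  rw [h3]
  congr 1; ext x
  rw [smul_eq_mul, Complex.real_smul, mul_comm]

/-! ### A one-sided cutoff and the contour argument -/

/-- The function `s e^{-s}` on `s > 0`, extended by zero. -/
noncomputable def gammaTwo (s : ℝ) : ℂ := ((max s 0 * Real.exp (-s) : ℝ) : ℂ)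

lemma continuous_gammaTwo : Continuous gammaTwo := by unfold gammaTwo; fun_prop

lemma gammaTwo_ne_zero {s : ℝ} (hs : 0 < s) : gammaTwo s ≠ 0 := by
  rw [gammaTwo, max_eq_left hs.le]
  exact_mod_cast (mul_pos hs (Real.exp_pos _)).ne'

lemma gammaTwo_eq_indicator :
    gammaTwo = (Set.Ioi (0 : ℝ)).indicator fun s => ((s * Real.exp (-s) : ℝ) : ℂ) := by
  ext s
  by_cases h : 0 < s
  · rw [Set.indicator_of_mem (show s ∈ Set.Ioi (0 : ℝ) from h), gammaTwo, max_eq_left h.le]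
  · rw [Set.indicator_of_notMem (show s ∉ Set.Ioi (0 : ℝ) from h), gammaTwo,
      max_eq_right (not_lt.1 h)]
    simp

lemma integrableOn_mul_exp_neg :
    IntegrableOn (fun s : ℝ => s * Real.exp (-s)) (Set.Ioi 0) := by
  refine (Real.GammaIntegral_convergent two_pos).congr_fun (fun s hs => ?_) measurableSet_Ioi
  dsimp only
  rw [show (2 : ℝ) - 1 = 1 by norm_num, Real.rpow_one, mul_comm]

lemma integrable_gammaTwo : Integrable gammaTwo := by
  rw [gammaTwo_eq_indicator, integrable_indicator_iff measurableSet_Ioi]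
  exact integrableOn_mul_exp_neg.ofReal

lemma integral_mul_exp_neg_mul {z : ℂ} (hz : z.re = 1) :
    ∫ s in Set.Ioi (0 : ℝ), (s : ℂ) * Complex.exp (-(z * s)) = 1 / z ^ 2 := by
  have hz0 : z ≠ 0 := by rintro rfl; simp at hz
  have hexp : ∀ s : ℝ, ‖Complex.exp (-(z * s))‖ = Real.exp (-s) := by
    intro s; rw [Complex.norm_exp]; simp [hz]
  have hd : ∀ s ∈ Set.Ici (0 : ℝ), HasDerivAt
      (fun s : ℝ => -((s : ℂ) / z + 1 / z ^ 2) * Complex.exp (-(z * s)))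
      ((s : ℂ) * Complex.exp (-(z * s))) s := by
    intro s _
    have h1 : HasDerivAt (fun s : ℂ => -(s / z + 1 / z ^ 2) * Complex.exp (-(z * s)))
        (s * Complex.exp (-(z * s))) s := by
      have h2 : HasDerivAt (fun s : ℂ => -(s / z + 1 / z ^ 2)) (-(1 / z)) (s : ℂ) :=
        (((hasDerivAt_id (s : ℂ)).div_const z).add_const _).neg
      have h3 : HasDerivAt (fun s : ℂ => Complex.exp (-(z * s)))
          (Complex.exp (-(z * s)) * (-(z * 1))) (s : ℂ) :=
        ((hasDerivAt_id (s : ℂ)).const_mul z).neg.cexp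
      refine (h2.mul h3).congr_deriv ?_
      field_simp
      ring
    exact h1.comp_ofReal
  have hint : IntegrableOn (fun s : ℝ => (s : ℂ) * Complex.exp (-(z * s))) (Set.Ioi 0) := by
    refine integrableOn_mul_exp_neg.mono' (by fun_prop) ?_
    filter_upwards [ae_restrict_mem measurableSet_Ioi] with s hs
    rw [norm_mul, hexp, Complex.norm_real, Real.norm_of_nonneg (le_of_lt hs)]
  have hlim : Filter.Tendsto
      (fun s : ℝ => -((s : ℂ) / z + 1 / z ^ 2) * Complex.exp (-(z * s))) Filter.atTop (nhds 0) := by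
    rw [tendsto_zero_iff_norm_tendsto_zero]
    have h0 := Real.tendsto_exp_neg_atTop_nhds_zero
    have h1 := Real.tendsto_pow_mul_exp_neg_atTop_nhds_zero 1
    have h2 := (h1.const_mul ‖1 / z‖).add (h0.const_mul ‖1 / z ^ 2‖)
    simp only [mul_zero, add_zero] at h2
    refine squeeze_zero' (Filter.Eventually.of_forall fun s => norm_nonneg _) ?_ h2
    filter_upwards [Filter.eventually_ge_atTop 0] with s hs
    rw [norm_mul, hexp, norm_neg, pow_one, ← mul_assoc, ← add_mul]
    refine mul_le_mul_of_nonneg_right ((norm_add_le _ _).trans ?_) (Real.exp_pos _).le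
    refine add_le_add (le_of_eq ?_) le_rfl
    rw [div_eq_mul_one_div, norm_mul, Complex.norm_real, Real.norm_of_nonneg hs, mul_comm]
  rw [integral_Ioi_of_hasDerivAt_of_tendsto' hd hint hlim]
  simp

/-- The Fourier transform of `gammaTwo`, up to a reflection. -/
noncomputable def resolventSq (z : ℂ) : ℂ := 1 / (1 - 2 * Real.pi * Complex.I * z) ^ 2

-- The reason for choosing `s e^{-s}`: it is continuous, nonzero exactly on `s > 0`, and its
-- transform is holomorphic on the closed upper half-plane with decay of order `|z|^{-2}`. That
-- decay compensates for the absence of any decay of `F` along the reals.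
open scoped FourierTransform in
lemma fourierInv_gammaTwo (w : ℝ) : 𝓕⁻ gammaTwo w = resolventSq w := by
  rw [Real.fourierInv_eq', resolventSq, ← integral_mul_exp_neg_mul (by simp),
    ← integral_indicator measurableSet_Ioi, gammaTwo_eq_indicator]
  congr 1; ext s
  by_cases h : 0 < s
  · rw [Set.indicator_of_mem (show s ∈ Set.Ioi (0 : ℝ) from h),
      Set.indicator_of_mem (show s ∈ Set.Ioi (0 : ℝ) from h), smul_eq_mul]
    push_cast
    rw [mul_left_comm, ← Complex.exp_add]
    simp only [RCLike.inner_apply, conj_trivial, Complex.ofReal_mul]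
    congr 2; ring
  · rw [Set.indicator_of_notMem (show s ∉ Set.Ioi (0 : ℝ) from h),
      Set.indicator_of_notMem (show s ∉ Set.Ioi (0 : ℝ) from h), smul_zero]

lemma normSq_resolvent_denom (z : ℂ) : ‖(1 - 2 * Real.pi * Complex.I * z) ^ 2‖ =
    (1 + 2 * Real.pi * z.im) ^ 2 + (2 * Real.pi * z.re) ^ 2 := by
  rw [norm_pow, ← Complex.normSq_eq_norm_sq, Complex.normSq_apply]
  simp; ring

/-- The only zero of the denominator is `-i / (2π)`, below the real axis; above it all terms of the
expanded square are nonnegative, and `2π ≥ 1`. -/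
lemma one_add_norm_sq_le_resolvent_denom {z : ℂ} (hz : 0 ≤ z.im) :
    1 + ‖z‖ ^ 2 ≤ ‖(1 - 2 * Real.pi * Complex.I * z) ^ 2‖ := by
  rw [normSq_resolvent_denom, ← Complex.normSq_eq_norm_sq, Complex.normSq_apply]
  have hpi : 1 ≤ 2 * Real.pi := by linarith [Real.pi_gt_three]
  have h1 : z.im ≤ 2 * Real.pi * z.im := le_mul_of_one_le_left hz hpi
  have h2 : z.re ^ 2 ≤ (2 * Real.pi * z.re) ^ 2 := by
    rw [mul_pow]; exact le_mul_of_one_le_left (sq_nonneg _) (one_le_pow₀ hpi)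
  nlinarith

lemma norm_resolventSq_le {z : ℂ} (hz : 0 ≤ z.im) : ‖resolventSq z‖ ≤ (1 + ‖z‖ ^ 2)⁻¹ := by
  rw [resolventSq, norm_div, norm_one, one_div]
  exact inv_anti₀ (by positivity) (one_add_norm_sq_le_resolvent_denom hz)

lemma differentiableAt_resolventSq {z : ℂ} (hz : 0 ≤ z.im) :
    DifferentiableAt ℂ resolventSq z := by
  unfold resolventSq
  refine DifferentiableAt.div (by fun_prop) (by fun_prop) ?_
  rw [← norm_pos_iff]
  exact lt_of_lt_of_le (by positivity) (one_add_norm_sq_le_resolvent_denom hz)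

lemma continuous_resolventSq_ofReal : Continuous fun w : ℝ => resolventSq w :=
  continuous_iff_continuousAt.2 fun w =>
    ContinuousAt.comp (f := fun w : ℝ => (w : ℂ))
      (differentiableAt_resolventSq (by simp)).continuousAt Complex.continuous_ofReal.continuousAt

lemma integrable_resolventSq : Integrable fun w : ℝ => resolventSq w := by
  refine integrable_inv_one_add_sq.mono' continuous_resolventSq_ofReal.aestronglyMeasurable
    (Filter.Eventually.of_forall fun w => ?_)
  refine (norm_resolventSq_le (by simp)).trans (le_of_eq ?_)
  rw [Complex.norm_real, Real.norm_eq_abs, sq_abs]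

open scoped FourierTransform in
lemma integral_resolventSq_mul_exp (s : ℝ) :
    ∫ w : ℝ, resolventSq w * Complex.exp (-(2 * Real.pi * s * w : ℝ) * Complex.I) =
      gammaTwo s := by
  have h1 : 𝓕⁻ gammaTwo = fun w : ℝ => resolventSq w := funext fourierInv_gammaTwo
  have h2 : Integrable (𝓕 gammaTwo) := by
    have h3 : 𝓕 gammaTwo = fun w => 𝓕⁻ gammaTwo (-w) := by
      ext w; rw [Real.fourierInv_eq_fourier_neg, neg_neg]
    rw [h3, h1]
    exact integrable_resolventSq.comp_neg
  have h4 := congrFun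
    (continuous_gammaTwo.fourier_fourierInv_eq integrable_gammaTwo h2) s
  rw [h1, Real.fourier_eq'] at h4
  rw [← h4]
  congr 1; ext w
  rw [smul_eq_mul, mul_comm]
  congr 3
  simp only [RCLike.inner_apply, conj_trivial]
  push_cast; ring

/-- Vanishing of a contour integral over the upper half-plane for entire functions of
exponential type. -/
lemma integral_resolventSq_mul_eq_zero {K : ℂ → ℂ} (hK : Differentiable ℂ K) {c A : ℝ}
    (hc : ∀ z, ‖K z‖ ≤ c * Real.exp (A * |z.im|)) :
    ∫ w : ℝ, resolventSq w * (Complex.exp (A * w * Complex.I) * K w) = 0 := by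
  set f : ℂ → ℂ := fun z => resolventSq z * (Complex.exp (A * z * Complex.I) * K z) with hf
  have hc0 : 0 ≤ c := by
    have := (norm_nonneg _).trans (hc 0)
    simpa using this
  -- For `Im z ≥ 0` the factor `e^{iAz}` has modulus `e^{-A Im z}`, which cancels the growth of `K`
  -- exactly.
  have hbound : ∀ z : ℂ, 0 ≤ z.im → ‖f z‖ ≤ c * (1 + ‖z‖ ^ 2)⁻¹ := by
    intro z hz
    have h1 : ‖Complex.exp (A * z * Complex.I) * K z‖ ≤ c := by
      rw [norm_mul, Complex.norm_exp]
      have h2 := hc z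
      rw [abs_of_nonneg hz] at h2
      calc _ ≤ Real.exp (A * z * Complex.I).re * (c * Real.exp (A * z.im)) := by gcongr
        _ = c := by
          rw [mul_left_comm, ← Real.exp_add]
          simp
    rw [hf, norm_mul, mul_comm c]
    exact mul_le_mul (norm_resolventSq_le hz) h1 (norm_nonneg _) (by positivity)
  have hdiff : ∀ z : ℂ, 0 ≤ z.im → DifferentiableAt ℂ f z := fun z hz =>
    (differentiableAt_resolventSq hz).mul (by fun_prop)
  have hcont : Continuous fun w : ℝ => f w :=
    continuous_iff_continuousAt.2 fun w => ContinuousAt.comp (f := fun w : ℝ => (w : ℂ))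
      (hdiff _ (by simp)).continuousAt Complex.continuous_ofReal.continuousAt
  have hint : Integrable fun w : ℝ => f w := by
    refine (integrable_inv_one_add_sq.const_mul c).mono' hcont.aestronglyMeasurable
      (Filter.Eventually.of_forall fun w => ?_)
    refine (hbound w (by simp)).trans (le_of_eq ?_)
    rw [Complex.norm_real, Real.norm_eq_abs, sq_abs]
  have hlim := intervalIntegral_tendsto_integral hint Filter.tendsto_neg_atTop_atBot
    Filter.tendsto_id
  refine tendsto_nhds_unique hlim ?_
  rw [tendsto_zero_iff_norm_tendsto_zero]
  -- The constant `4` is `2 + 1 + 1`: the top side of the rectangle has length `2T`, each vertical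
  -- side length `T`, and `f` is at most `c T^{-2}` on all three.
  have hT0 : Filter.Tendsto (fun T : ℝ => 4 * c * T⁻¹) Filter.atTop (nhds 0) := by
    simpa using tendsto_inv_atTop_zero.const_mul (4 * c)
  refine squeeze_zero' (Filter.Eventually.of_forall fun _ => norm_nonneg _) ?_ hT0
  filter_upwards [Filter.eventually_gt_atTop 0] with T hT
  have hrect := Complex.integral_boundary_rect_eq_zero_of_differentiableOn f (-T : ℂ)
    (T + T * Complex.I) (fun z hz => (hdiff z (by
      have := hz.2
      simp [Set.uIcc_of_le hT.le] at this
      exact this.1)).differentiableWithinAt)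
  simp only [Complex.neg_re, Complex.ofReal_re, Complex.add_re, Complex.mul_re, Complex.I_re,
    mul_zero, Complex.ofReal_im, Complex.I_im, mul_one, sub_self, add_zero, Complex.neg_im,
    neg_zero, Complex.ofReal_zero, zero_mul, Complex.add_im, Complex.mul_im, zero_add] at hrect
  have hb : ∀ z : ℂ, 0 ≤ z.im → T ≤ ‖z‖ → ‖f z‖ ≤ c * (T ^ 2)⁻¹ := by
    intro z hz hTz
    refine (hbound z hz).trans ?_
    gcongr
    nlinarith
  have e1 : ‖∫ x : ℝ in (-T)..T, f (x + T * Complex.I)‖ ≤ c * (T ^ 2)⁻¹ * |T - -T| :=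
    intervalIntegral.norm_integral_le_of_norm_le_const fun x _ => hb _ (by simp [hT.le]) (by
      have := Complex.abs_im_le_norm ((x : ℂ) + T * Complex.I)
      simp at this
      exact (le_abs_self T).trans this)
  have e2 : ∀ X : ℝ, |X| = T →
      ‖∫ y : ℝ in (0 : ℝ)..T, f (X + y * Complex.I)‖ ≤ c * (T ^ 2)⁻¹ * |T - 0| := by
    intro X hX
    refine intervalIntegral.norm_integral_le_of_norm_le_const fun y hy => hb _ ?_ ?_
    · rw [Set.uIoc_of_le hT.le] at hy
      simp [hy.1.le]
    · have := Complex.abs_re_le_norm ((X : ℂ) + y * Complex.I)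
      simp at this
      rwa [← hX]
  have e3 := e2 T (abs_of_pos hT)
  have e4 := e2 (-T) (by rw [abs_neg, abs_of_pos hT])
  rw [sub_zero, abs_of_pos hT] at e3 e4
  rw [sub_neg_eq_add, abs_of_pos (by linarith)] at e1
  have e5 : ∫ x : ℝ in (-T)..T, f x = (∫ x : ℝ in (-T)..T, f (x + T * Complex.I)) -
      Complex.I • (∫ y : ℝ in (0 : ℝ)..T, f (T + y * Complex.I)) +
      Complex.I • (∫ y : ℝ in (0 : ℝ)..T, f ((-T : ℝ) + y * Complex.I)) := by
    linear_combination hrect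
  simp only [id]
  rw [e5]
  refine (norm_add_le _ _).trans ?_
  refine (add_le_add (norm_sub_le _ _) le_rfl).trans ?_
  rw [norm_smul, norm_smul, Complex.norm_I, one_mul, one_mul]
  have e6 : c * (T ^ 2)⁻¹ * (T + T) + c * (T ^ 2)⁻¹ * T + c * (T ^ 2)⁻¹ * T = 4 * c * T⁻¹ := by
    field_simp; ring
  linarith

/-! ### From a half-line to the whole line -/

/-- An entire function that agrees on `(0, ∞)` with a smooth even function on the line agrees with
it everywhere on the line. -/
lemma eq_of_contDiff_even_of_eq_pos {F : ℂ → ℂ} (hF : Differentiable ℂ F) {G : ℝ → ℂ}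
    (hG : ∀ n : ℕ, ContDiff ℝ n G) (hev : ∀ t, G (-t) = G t)
    (h : ∀ t : ℝ, 0 < t → F t = G t) (t : ℝ) : F t = G t := by
  set A : ℝ → ℂ := fun t => F t with hA
  have hAan : AnalyticOnNhd ℝ A Set.univ := fun x _ => by
    have h1 : AnalyticAt ℝ F (x : ℂ) :=
      (hF.analyticAt (x : ℂ)).restrictScalars
    exact h1.comp (Complex.ofRealCLM.analyticAt x)
  have hAc : ∀ n : ℕ, ContDiff ℝ n A := fun n => contDiffOn_univ.1 (hAan.contDiffOn uniqueDiffOn_univ)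
  set D : ℝ → ℂ := fun t => A t - G t with hD
  have hDc : ∀ n : ℕ, ContDiff ℝ n D := fun n => (hAc n).sub (hG n)
  have hD0 : ∀ t : ℝ, 0 < t → D t = 0 := fun t ht => sub_eq_zero.2 (h t ht)
  -- The smooth difference vanishes on `t > 0`, so right limits make all its derivatives vanish at
  -- `0`. It need not be analytic, so this alone says nothing about `t < 0`.
  have hDn : ∀ n : ℕ, iteratedDeriv n D 0 = 0 := by
    intro n
    have hcont : Continuous (iteratedDeriv n D) := (hDc n).continuous_iteratedDeriv n le_rfl
    have hpos : ∀ t : ℝ, 0 < t → iteratedDeriv n D t = 0 := by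
      intro t ht
      have : D =ᶠ[nhds t] fun _ => 0 := by
        filter_upwards [Ioi_mem_nhds ht] with x hx using hD0 x hx
      rw [this.iteratedDeriv_eq n]
      simp
    have h1 : Filter.Tendsto (iteratedDeriv n D) (nhdsWithin 0 (Set.Ioi 0))
        (nhds (iteratedDeriv n D 0)) := hcont.continuousAt.tendsto.mono_left nhdsWithin_le_nhds
    refine tendsto_nhds_unique h1 (tendsto_const_nhds.congr' ?_)
    filter_upwards [self_mem_nhdsWithin] with x hx using (hpos x hx).symm
  -- Twice the odd part of `A` is analytic, and since `G` is even it equals `D t - D (-t)`, which is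
  -- flat at `0`. Hence it vanishes identically and `A` is even.
  set B : ℝ → ℂ := fun t => A t - A (-t) with hB
  have hBan : AnalyticOnNhd ℝ B Set.univ := fun x _ =>
    (hAan x trivial).sub ((hAan (-x) trivial).comp (f := fun x : ℝ => -x) analyticAt_id.neg)
  have hBD : B = fun t => D t - D (-t) := by
    ext t; simp only [hB, hD, hev]; ring
  have hBn : ∀ n : ℕ, iteratedDeriv n B 0 = 0 := by
    intro n
    have h2 : ContDiff ℝ n fun t => D (-t) := (hDc n).comp contDiff_neg
    rw [hBD, iteratedDeriv_fun_sub (hDc n).contDiffAt h2.contDiffAt, iteratedDeriv_comp_neg,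
      neg_zero, hDn]
    simp
  have hB0 : B = 0 := by
    have h1 : analyticOrderAt B 0 = ⊤ := by
      refine ENat.eq_top_iff_forall_ge.2 fun n => ?_
      exact (natCast_le_analyticOrderAt_iff_iteratedDeriv_eq_zero (hBan 0 trivial)).2
        fun i _ => hBn i
    exact hBan.eq_of_eventuallyEq (g := 0) (fun x _ => analyticAt_const)
      (analyticOrderAt_eq_top.1 h1)
  rcases lt_trichotomy t 0 with ht | rfl | ht
  · have h1 : A t = A (-t) := sub_eq_zero.1 (congrFun hB0 t)
    have h2 : A (-t) = G (-t) := h (-t) (by linarith)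
    rw [← hev, ← h2, ← h1]
  · have := hDn 0
    rw [iteratedDeriv_zero] at this
    exact sub_eq_zero.1 this
  · exact h t ht

/-! ### Exchanging the last coordinate with an auxiliary variable -/

section UpdateLast

variable {d : ℕ}

/-- Replace the last coordinate of a vector. -/
noncomputable def updateLast {𝕜 : Type*} (x : EuclideanSpace 𝕜 (Fin (d + 1))) (t : 𝕜) :
    EuclideanSpace 𝕜 (Fin (d + 1)) :=
  WithLp.toLp 2 (Function.update (fun i => x i) (Fin.last d) t)

@[simp] lemma updateLast_last {𝕜 : Type*} (x : EuclideanSpace 𝕜 (Fin (d + 1))) (t : 𝕜) :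
    updateLast x t (Fin.last d) = t := by
  simp [updateLast]

@[simp] lemma updateLast_castSucc {𝕜 : Type*} (x : EuclideanSpace 𝕜 (Fin (d + 1))) (t : 𝕜)
    (j : Fin d) : updateLast x t j.castSucc = x j.castSucc := by
  simp [updateLast]

lemma ext_castSucc_last {𝕜 : Type*} {x y : EuclideanSpace 𝕜 (Fin (d + 1))}
    (h : ∀ j : Fin d, x j.castSucc = y j.castSucc) (hl : x (Fin.last d) = y (Fin.last d)) :
    x = y := by
  ext i
  refine Fin.lastCases hl h i

@[simp] lemma updateLast_self {𝕜 : Type*} (x : EuclideanSpace 𝕜 (Fin (d + 1))) :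
    updateLast x (x (Fin.last d)) = x :=
  ext_castSucc_last (by simp) (by simp)

@[simp] lemma updateLast_updateLast {𝕜 : Type*} (x : EuclideanSpace 𝕜 (Fin (d + 1))) (s t : 𝕜) :
    updateLast (updateLast x s) t = updateLast x t :=
  ext_castSucc_last (by simp) (by simp)

lemma norm_updateLast_sq (x : EuclideanSpace ℝ (Fin (d + 1))) (t : ℝ) :
    ‖updateLast x t‖ ^ 2 = ‖x‖ ^ 2 - x (Fin.last d) ^ 2 + t ^ 2 := by
  simp [EuclideanSpace.real_norm_sq_eq, Fin.sum_univ_castSucc]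

lemma norm_le_norm_updateLast {x : EuclideanSpace ℝ (Fin (d + 1))} {t : ℝ}
    (h : |x (Fin.last d)| ≤ |t|) : ‖x‖ ≤ ‖updateLast x t‖ := by
  have h1 := norm_updateLast_sq x t
  have h2 := sq_le_sq.2 h
  exact le_of_sq_le_sq (by linarith) (norm_nonneg _)

/-- The involution of `ℝ^(d+1) × ℝ` exchanging the last coordinate with the extra variable. -/
noncomputable def swapLast (d : ℕ) :
    (EuclideanSpace ℝ (Fin (d + 1)) × ℝ) →ₗ[ℝ] (EuclideanSpace ℝ (Fin (d + 1)) × ℝ) where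
  toFun p := (updateLast p.1 p.2, p.1 (Fin.last d))
  map_add' p q := Prod.ext (ext_castSucc_last (by simp) (by simp)) (by simp)
  map_smul' c p := Prod.ext (ext_castSucc_last (by simp) (by simp)) (by simp)

lemma swapLast_apply (p : EuclideanSpace ℝ (Fin (d + 1)) × ℝ) :
    swapLast d p = (updateLast p.1 p.2, p.1 (Fin.last d)) := rfl

@[simp] lemma swapLast_swapLast (p : EuclideanSpace ℝ (Fin (d + 1)) × ℝ) :
    swapLast d (swapLast d p) = p := by
  simp [swapLast_apply]

lemma continuous_swapLast : Continuous (swapLast d) :=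
  LinearMap.continuous_of_finiteDimensional _

lemma continuous_updateLast :
    Continuous fun p : EuclideanSpace ℝ (Fin (d + 1)) × ℝ => updateLast p.1 p.2 :=
  continuous_fst.comp continuous_swapLast

/-- A linear involution has determinant `1` or `-1`. -/
lemma measurePreserving_swapLast :
    MeasurePreserving (swapLast d) (volume.prod volume) (volume.prod volume) := by
  have hdet : LinearMap.det (swapLast d) * LinearMap.det (swapLast d) = 1 := by
    rw [← LinearMap.det_comp]
    have : (swapLast d) ∘ₗ (swapLast d) = LinearMap.id := by
      exact LinearMap.ext fun p => by simp
    rw [this, LinearMap.det_id]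
  have h0 : LinearMap.det (swapLast d) ≠ 0 := by
    intro h; rw [h] at hdet; simp at hdet
  refine ⟨continuous_swapLast.measurable, ?_⟩
  rw [Measure.map_linearMap_addHaar_eq_smul_addHaar _ h0]
  have h1 : |(LinearMap.det (swapLast d))⁻¹| = 1 := by
    rcases mul_self_eq_one_iff.1 hdet with h | h <;> rw [h] <;> norm_num
  rw [h1]; simp

lemma integrable_comp_swapLast {X : Type*} [NormedAddCommGroup X]
    {g : EuclideanSpace ℝ (Fin (d + 1)) × ℝ → X}
    (hg : Integrable g (volume.prod volume)) :
    Integrable (fun p => g (swapLast d p)) (volume.prod volume) :=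
  measurePreserving_swapLast.integrable_comp_of_integrable hg

/-- `swapLast` as a measurable equivalence. -/
noncomputable def swapLastEquiv (d : ℕ) :
    (EuclideanSpace ℝ (Fin (d + 1)) × ℝ) ≃ᵐ (EuclideanSpace ℝ (Fin (d + 1)) × ℝ) where
  toFun := swapLast d
  invFun := swapLast d
  left_inv := swapLast_swapLast
  right_inv := swapLast_swapLast
  measurable_toFun := continuous_swapLast.measurable
  measurable_invFun := continuous_swapLast.measurable

lemma integral_comp_swapLast (g : EuclideanSpace ℝ (Fin (d + 1)) × ℝ → ℂ) :
    ∫ p, g (swapLast d p) ∂(volume.prod volume) = ∫ p, g p ∂(volume.prod volume) :=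
  MeasurePreserving.integral_comp (f := swapLast d) measurePreserving_swapLast
    (swapLastEquiv d).measurableEmbedding g

end UpdateLast

/-! ### The Weyl transform and the factorization of the Weinstein transform -/

section WeylTransform

variable {d : ℕ}

/-- The integral kernel of the Weyl transform of `φ`. -/
noncomputable def weylKernel (a : ℝ) (φ : EuclideanSpace ℝ (Fin (d + 1)) → ℂ)
    (p : EuclideanSpace ℝ (Fin (d + 1)) × ℝ) : ℂ :=
  ((poissonConst a * p.1 (Fin.last d) * abelKernel a (p.1 (Fin.last d)) p.2 : ℝ) : ℂ) * φ p.1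

/-- The Weyl transform of `φ` in the last variable:
`C ∫_{|y_{d+1}|}^∞ φ(y', s) (s² - y_{d+1}²)^(a - 1/2) s ds`. -/
noncomputable def weylTransform (a : ℝ) (φ : EuclideanSpace ℝ (Fin (d + 1)) → ℂ)
    (y : EuclideanSpace ℝ (Fin (d + 1))) : ℂ :=
  ∫ s, weylKernel a φ (swapLast d (y, s))

lemma measurable_weylKernel (a : ℝ) {φ : EuclideanSpace ℝ (Fin (d + 1)) → ℂ}
    (hφ : Measurable φ) : Measurable (weylKernel a φ) := by
  unfold weylKernel
  have h1 : Measurable fun p : EuclideanSpace ℝ (Fin (d + 1)) × ℝ => p.1 (Fin.last d) := by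
    fun_prop
  have h2 := (measurable_abelKernel a).comp (h1.prodMk measurable_snd)
  exact (Complex.measurable_ofReal.comp ((h1.const_mul _).mul h2)).mul (hφ.comp measurable_fst)

lemma abelKernel_of_le {a s t : ℝ} (h : s ≤ |t|) : abelKernel a s t = 0 :=
  if_neg (not_lt.2 h)

lemma rpow_le_one_add_pow {p s r : ℝ} (hp : 0 ≤ p) {M : ℕ} (hM : p ≤ M) (hs : 0 < s)
    (hsr : s ≤ r) : s ^ p ≤ 1 + r ^ M := by
  rcases le_or_gt s 1 with h | h
  · have := Real.rpow_le_one hs.le h hp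
    have h2 : 0 ≤ r ^ M := pow_nonneg (hs.le.trans hsr) _
    linarith
  · have h1 : s ^ p ≤ s ^ (M : ℝ) := Real.rpow_le_rpow_of_exponent_le h.le hM
    rw [Real.rpow_natCast] at h1
    have h2 : s ^ M ≤ r ^ M := pow_le_pow_left₀ hs.le hsr M
    linarith

lemma last_le_norm (x : EuclideanSpace ℝ (Fin (d + 1))) : x (Fin.last d) ≤ ‖x‖ :=
  (le_abs_self _).trans (PiLp.norm_apply_le x (Fin.last d))

/-- Integrating the Abel kernel in `t` leaves a constant times `x_{d+1}^(2a+1) ‖φ x‖` on the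
half-space, which Schwartz decay controls. The weights `‖x‖^N` later yield smoothness of the
Weinstein transform. -/
lemma integrable_pow_mul_weylKernel {a : ℝ} (ha : -(1 / 2 : ℝ) < a)
    (φ : 𝓢(EuclideanSpace ℝ (Fin (d + 1)), ℂ)) (N : ℕ) :
    Integrable (fun p => ‖p.1‖ ^ N * ‖weylKernel a φ p‖) (volume.prod volume) := by
  have hmeas : Measurable fun p : EuclideanSpace ℝ (Fin (d + 1)) × ℝ =>
      ‖p.1‖ ^ N * ‖weylKernel a φ p‖ :=
    (measurable_fst.norm.pow_const N).mul (measurable_weylKernel a φ.continuous.measurable).norm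
  have hnorm : ∀ x : EuclideanSpace ℝ (Fin (d + 1)), ∀ t : ℝ, ‖weylKernel a φ (x, t)‖ =
      |poissonConst a * x (Fin.last d)| * ‖φ x‖ * abelKernel a (x (Fin.last d)) t := by
    intro x t
    rw [weylKernel, norm_mul, Complex.norm_real, Real.norm_eq_abs, abs_mul,
      abs_of_nonneg (abelKernel_nonneg _ _ _)]
    ring
  rw [integrable_prod_iff hmeas.aestronglyMeasurable]
  refine ⟨Filter.Eventually.of_forall fun x => ?_, ?_⟩
  · simp only [hnorm]
    exact ((integrable_abelKernel ha _).const_mul _).const_mul _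
  · obtain ⟨M, hM⟩ := exists_nat_ge (2 * a + 1)
    set B := ProbabilityTheory.beta (1 / 2) (a + 1 / 2) with hB
    have hB0 : 0 < B := ProbabilityTheory.beta_pos (by norm_num) (by linarith)
    have hC := poissonConst_pos ha
    have hbd : Integrable fun x : EuclideanSpace ℝ (Fin (d + 1)) =>
        (poissonConst a * B) * (‖x‖ ^ N * ‖φ x‖ + ‖x‖ ^ (N + M) * ‖φ x‖) :=
      ((φ.integrable_pow_mul volume N).add (φ.integrable_pow_mul volume (N + M))).const_mul _
    refine hbd.mono' hmeas.norm.stronglyMeasurable.integral_prod_right.aestronglyMeasurable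
      (Filter.Eventually.of_forall fun x => ?_)
    simp only [norm_mul, norm_pow, hnorm, abs_norm, Real.norm_eq_abs, abs_abs,
      abs_of_nonneg (abelKernel_nonneg _ _ _)]
    rw [integral_const_mul, integral_const_mul]
    rcases le_or_gt (x (Fin.last d)) 0 with hx | hx
    · have h0 : ∀ t, abelKernel a (x (Fin.last d)) t = 0 := fun t =>
        abelKernel_of_le (hx.trans (abs_nonneg t))
      simp only [h0, integral_zero, mul_zero, abs_zero]
      positivity
    · have h1 : x (Fin.last d) * x (Fin.last d) ^ (2 * a) = x (Fin.last d) ^ (2 * a + 1) := by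
        rw [Real.rpow_add hx, Real.rpow_one, mul_comm]
      have h2 := rpow_le_one_add_pow (p := 2 * a + 1) (by linarith) hM hx (last_le_norm x)
      rw [integral_abelKernel ha hx, ← hB, abs_of_nonneg (by positivity),
        abs_of_pos (mul_pos hC hx)]
      calc ‖x‖ ^ N * (poissonConst a * x (Fin.last d) * ‖φ x‖ * (x (Fin.last d) ^ (2 * a) * B))
          = (poissonConst a * B) * (‖x‖ ^ N * ‖φ x‖ *
            (x (Fin.last d) * x (Fin.last d) ^ (2 * a))) := by ring
        _ ≤ (poissonConst a * B) * (‖x‖ ^ N * ‖φ x‖ * (1 + ‖x‖ ^ M)) := by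
          rw [h1]; gcongr
        _ = _ := by rw [pow_add]; ring

lemma weylKernel_swapLast (a : ℝ) (φ : EuclideanSpace ℝ (Fin (d + 1)) → ℂ)
    (y : EuclideanSpace ℝ (Fin (d + 1))) (s : ℝ) :
    weylKernel a φ (swapLast d (y, s)) =
      ((poissonConst a * s * abelKernel a s (y (Fin.last d)) : ℝ) : ℂ) * φ (updateLast y s) := by
  simp [weylKernel, swapLast_apply]

/-- Where the kernel is nonzero, `s > |y_{d+1}|`, so `‖y‖` is at most the norm of the point where
`φ` is evaluated and the weight passes to `y`. -/
lemma integrable_pow_mul_weylKernel_swapLast {a : ℝ} (ha : -(1 / 2 : ℝ) < a)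
    (φ : 𝓢(EuclideanSpace ℝ (Fin (d + 1)), ℂ)) (N : ℕ) :
    Integrable (fun p => ‖p.1‖ ^ N * ‖weylKernel a φ (swapLast d p)‖)
      (volume.prod volume) := by
  refine (integrable_comp_swapLast (integrable_pow_mul_weylKernel ha φ N)).mono' ?_
    (Filter.Eventually.of_forall fun p => ?_)
  · exact ((measurable_fst.norm.pow_const N).mul ((measurable_weylKernel a
      φ.continuous.measurable).comp continuous_swapLast.measurable).norm).aestronglyMeasurable
  · obtain ⟨y, s⟩ := p
    rw [norm_mul, norm_norm, norm_pow, norm_norm]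
    rcases lt_or_ge |y (Fin.last d)| s with h | h
    · gcongr
      exact norm_le_norm_updateLast (h.le.trans (le_abs_self s))
    · rw [weylKernel_swapLast, abelKernel_of_le h]
      simp

lemma integrable_weylKernel_swapLast {a : ℝ} (ha : -(1 / 2 : ℝ) < a)
    (φ : 𝓢(EuclideanSpace ℝ (Fin (d + 1)), ℂ)) :
    Integrable (fun p => weylKernel a φ (swapLast d p)) (volume.prod volume) := by
  have h := integrable_pow_mul_weylKernel_swapLast ha φ 0
  simp only [pow_zero, one_mul] at h
  exact (integrable_norm_iff ((measurable_weylKernel a φ.continuous.measurable).comp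
    continuous_swapLast.measurable).aestronglyMeasurable).1 h

lemma integrable_weylTransform {a : ℝ} (ha : -(1 / 2 : ℝ) < a)
    (φ : 𝓢(EuclideanSpace ℝ (Fin (d + 1)), ℂ)) : Integrable (weylTransform a φ) :=
  (integrable_weylKernel_swapLast ha φ).integral_prod_left

lemma integrable_pow_mul_weylTransform {a : ℝ} (ha : -(1 / 2 : ℝ) < a)
    (φ : 𝓢(EuclideanSpace ℝ (Fin (d + 1)), ℂ)) (N : ℕ) :
    Integrable (fun y => ‖y‖ ^ N * ‖weylTransform a φ y‖) := by
  refine (integrable_pow_mul_weylKernel_swapLast ha φ N).integral_prod_left.mono' ?_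
    (Filter.Eventually.of_forall fun y => ?_)
  · exact (continuous_norm.pow N).aestronglyMeasurable.mul
      (integrable_weylTransform ha φ).aestronglyMeasurable.norm
  · rw [norm_mul, norm_norm, norm_pow, norm_norm]
    dsimp only
    rw [integral_const_mul]
    gcongr
    exact norm_integral_le_integral_norm _

/-- Only `s > |y_{d+1}|` contributes, and raising the last coordinate to such an `s` cannot bring
the point closer to the origin. -/
lemma weylTransform_eq_zero {a : ℝ} {φ : EuclideanSpace ℝ (Fin (d + 1)) → ℂ} {R : ℝ}
    (hφ : ∀ x, R ≤ ‖x‖ → φ x = 0) {y : EuclideanSpace ℝ (Fin (d + 1))} (hy : R ≤ ‖y‖) :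
    weylTransform a φ y = 0 := by
  refine integral_eq_zero_of_ae (Filter.Eventually.of_forall fun s => ?_)
  dsimp only
  rw [weylKernel_swapLast]
  rcases lt_or_ge |y (Fin.last d)| s with h | h
  · rw [hφ _ (hy.trans (norm_le_norm_updateLast (h.le.trans (le_abs_self s)))), mul_zero]; rfl
  · rw [abelKernel_of_le h]; simp

/-- Fubini's theorem for the Weyl transform. -/
lemma integral_weylTransform_mul {a : ℝ} (ha : -(1 / 2 : ℝ) < a)
    (φ : 𝓢(EuclideanSpace ℝ (Fin (d + 1)), ℂ)) {e : EuclideanSpace ℝ (Fin (d + 1)) → ℂ}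
    (he : Continuous e) {c : ℝ} (hc : ∀ y, ‖e y‖ ≤ c) :
    ∫ y, weylTransform a φ y * e y =
      ∫ x, ∫ t, weylKernel a φ (x, t) * e (updateLast x t) := by
  have hi : Integrable (fun p => weylKernel a φ (swapLast d p) * e p.1)
      (volume.prod volume) :=
    (integrable_weylKernel_swapLast ha φ).mul_bdd (c := c)
      (he.comp continuous_fst).aestronglyMeasurable (Filter.Eventually.of_forall fun p => hc p.1)
  have hi' : Integrable (fun p => weylKernel a φ p * e (swapLast d p).1) (volume.prod volume) := by
    have := integrable_comp_swapLast hi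
    simpa only [swapLast_swapLast] using this
  calc ∫ y, weylTransform a φ y * e y
      = ∫ y, ∫ s, weylKernel a φ (swapLast d (y, s)) * e y := by
        congr 1; ext y; rw [weylTransform, integral_mul_const]
    _ = ∫ p, weylKernel a φ (swapLast d p) * e p.1 ∂(volume.prod volume) :=
        (integral_prod _ hi).symm
    _ = ∫ p, weylKernel a φ p * e (swapLast d p).1 ∂(volume.prod volume) := by
        rw [← integral_comp_swapLast (fun p => weylKernel a φ p * e (swapLast d p).1)]
        simp only [swapLast_swapLast]
    _ = _ := integral_prod _ hi'

/-- The exponential `exp(-i ∑ y_j ξ_j)`. -/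
noncomputable def expKernel {n : ℕ} (ξ : EuclideanSpace ℂ (Fin n)) (y : EuclideanSpace ℝ (Fin n)) :
    ℂ :=
  Complex.exp (-Complex.I * ∑ j, (y j : ℂ) * ξ j)

lemma continuous_expKernel {n : ℕ} (ξ : EuclideanSpace ℂ (Fin n)) : Continuous (expKernel ξ) := by
  unfold expKernel; fun_prop

lemma norm_expKernel {n : ℕ} (ξ : EuclideanSpace ℂ (Fin n)) (y : EuclideanSpace ℝ (Fin n)) :
    ‖expKernel ξ y‖ = Real.exp (∑ j, y j * (ξ j).im) := by
  rw [expKernel, Complex.norm_exp]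
  simp

lemma norm_expKernel_complexify {n : ℕ} (ξ y : EuclideanSpace ℝ (Fin n)) :
    ‖expKernel (complexify ξ) y‖ = 1 := by
  rw [norm_expKernel]; simp [complexify]

/-- Poisson's formula rescaled to `|t| < s` with `s = x_{d+1}` contributes `s^(2a)`; the extra
factor `s` in `weylKernel` completes it to the density `s^(2a+1)`. -/
lemma integral_weylKernel_mul_expKernel {a : ℝ} (ha : -(1 / 2 : ℝ) < a)
    (φ : EuclideanSpace ℝ (Fin (d + 1)) → ℂ) (x ξ : EuclideanSpace ℝ (Fin (d + 1))) :
    ∫ t, weylKernel a φ (x, t) * expKernel (complexify ξ) (updateLast x t) =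
      (halfSpace d).indicator (fun x => ((x (Fin.last d) ^ (2 * a + 1) : ℝ) : ℂ) *
        (φ x * weinsteinKernel a (complexify ξ) (complexify x))) x := by
  rcases le_or_gt (x (Fin.last d)) 0 with hx | hx
  · rw [Set.indicator_of_notMem (show x ∉ halfSpace d from not_lt.2 hx)]
    have h0 : ∀ t, abelKernel a (x (Fin.last d)) t = 0 := fun t =>
      abelKernel_of_le (hx.trans (abs_nonneg t))
    simp [weylKernel, h0]
  · rw [Set.indicator_of_mem (show x ∈ halfSpace d from hx)]
    set s := x (Fin.last d) with hs
    set E₀ := Complex.exp (-Complex.I * ∑ j : Fin d, (x j.castSucc : ℂ) * (ξ j.castSucc : ℂ))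
      with hE₀
    have h1 : ∀ t : ℝ, weylKernel a φ (x, t) * expKernel (complexify ξ) (updateLast x t) =
        ((poissonConst a * s : ℝ) : ℂ) * φ x * E₀ * ((abelKernel a s t : ℂ) *
          Complex.exp (-(t * ξ (Fin.last d) : ℝ) * Complex.I)) := by
      intro t
      have h2 : expKernel (complexify ξ) (updateLast x t) = E₀ *
          Complex.exp (-(t * ξ (Fin.last d) : ℝ) * Complex.I) := by
        rw [expKernel, hE₀, ← Complex.exp_add, Fin.sum_univ_castSucc]
        congr 1
        simp [complexify]
        ring
      rw [h2, weylKernel]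
      push_cast; ring
    have h3 : weinsteinKernel a (complexify ξ) (complexify x) =
        E₀ * normalizedBessel a ((s * ξ (Fin.last d) : ℝ) : ℂ) := by
      simp [weinsteinKernel, complexify, hE₀, hs]
    simp_rw [h1]
    rw [integral_const_mul, integral_comp_mul_abelKernel hx
      (fun t => Complex.exp (-(t * ξ (Fin.last d) : ℝ) * Complex.I)), h3,
      normalizedBessel_ofReal ha, Real.rpow_add hx, Real.rpow_one]
    have h4 : ∀ u : ℝ, s * u * ξ (Fin.last d) = u * (s * ξ (Fin.last d)) := fun u => by ring
    simp_rw [h4]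
    push_cast; ring

lemma measurableSet_halfSpace : MeasurableSet (halfSpace d) :=
  measurableSet_lt measurable_const (by fun_prop)

/-- The Weinstein transform is the Fourier transform of the Weyl transform. -/
lemma weinsteinTransform_eq {a : ℝ} (ha : -(1 / 2 : ℝ) < a)
    (φ : 𝓢(EuclideanSpace ℝ (Fin (d + 1)), ℂ)) (ξ : EuclideanSpace ℝ (Fin (d + 1))) :
    weinsteinTransform a φ ξ = ∫ y, weylTransform a φ y * expKernel (complexify ξ) y := by
  rw [integral_weylTransform_mul ha φ (continuous_expKernel _)
    (fun y => (norm_expKernel_complexify ξ y).le)]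
  simp_rw [integral_weylKernel_mul_expKernel ha]
  rw [integral_indicator measurableSet_halfSpace, weinsteinTransform, weinsteinMeasure,
    integral_withDensity_eq_integral_toReal_smul (by fun_prop)
      (Filter.Eventually.of_forall fun x => ENNReal.ofReal_lt_top)]
  refine setIntegral_congr_fun measurableSet_halfSpace fun x hx => ?_
  have hx' : 0 < x (Fin.last d) := hx
  dsimp only
  rw [ENNReal.toReal_ofReal (Real.rpow_nonneg hx'.le _), Complex.real_smul]

end WeylTransform

/-! ### Bounded support gives exponential type -/

section Forward

variable {d : ℕ}

lemma support_subset_ball_iff {φ : EuclideanSpace ℝ (Fin (d + 1)) → ℂ} {R : ℝ} :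
    Function.support φ ⊆ Metric.ball 0 R ↔ ∀ x, R ≤ ‖x‖ → φ x = 0 := by
  constructor
  · intro h x hx
    by_contra hne
    have := h hne
    rw [mem_ball_zero_iff] at this
    linarith
  · intro h x hx
    rw [mem_ball_zero_iff]
    by_contra hlt
    exact hx (h x (not_lt.1 hlt))

lemma sum_mul_im_le {n : ℕ} (y : EuclideanSpace ℝ (Fin n)) (ξ : EuclideanSpace ℂ (Fin n)) :
    ∑ j, y j * (ξ j).im ≤ ‖y‖ * ‖imPart ξ‖ := by
  have h := real_inner_le_norm (imPart ξ) y
  rw [mul_comm ‖y‖]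
  simpa [PiLp.inner_apply, imPart] using h

/-- The linear form `ξ ↦ ∑ y_j ξ_j`. -/
noncomputable def pairingCLM {n : ℕ} (y : EuclideanSpace ℝ (Fin n)) :
    EuclideanSpace ℂ (Fin n) →L[ℂ] ℂ :=
  ∑ j, (y j : ℂ) • EuclideanSpace.proj j

lemma pairingCLM_apply {n : ℕ} (y : EuclideanSpace ℝ (Fin n)) (ξ : EuclideanSpace ℂ (Fin n)) :
    pairingCLM y ξ = ∑ j, (y j : ℂ) * ξ j := by
  simp [pairingCLM]

lemma continuous_pairingCLM {n : ℕ} :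
    Continuous (pairingCLM : EuclideanSpace ℝ (Fin n) → _) := by
  unfold pairingCLM; fun_prop

lemma norm_pairingCLM_le {n : ℕ} (y : EuclideanSpace ℝ (Fin n)) : ‖pairingCLM y‖ ≤ ‖y‖ := by
  refine ContinuousLinearMap.opNorm_le_bound _ (norm_nonneg _) fun ξ => ?_
  rw [pairingCLM_apply]
  have h := norm_inner_le_norm (𝕜 := ℂ) (complexify y) ξ
  have h1 : ‖complexify y‖ = ‖y‖ := by
    simp [EuclideanSpace.norm_eq, complexify]
  rw [h1] at h
  simpa [PiLp.inner_apply, complexify, mul_comm] using h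

/-- Differentiation under the integral: `f` lives on `‖y‖ < R`, so the exponential and its
derivative are bounded uniformly for `ξ` in a unit ball. -/
lemma differentiable_integral_mul_expKernel {n : ℕ} {f : EuclideanSpace ℝ (Fin n) → ℂ}
    (hf : Integrable f) {R : ℝ} (hR : 0 ≤ R) (h0 : ∀ y, R ≤ ‖y‖ → f y = 0) :
    Differentiable ℂ fun ξ => ∫ y, f y * expKernel ξ y := by
  intro ξ₀
  have hb : ∀ ξ ∈ Metric.ball ξ₀ 1, ∀ y, ‖y‖ < R →
      ‖expKernel ξ y‖ ≤ Real.exp (R * (‖ξ₀‖ + 1)) := by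
    intro ξ hξ y hy
    rw [expKernel, ← pairingCLM_apply]
    refine (Complex.norm_exp_le_exp_norm _).trans (Real.exp_le_exp.2 ?_)
    rw [norm_mul, norm_neg, Complex.norm_I, one_mul]
    have h1 : ‖ξ‖ ≤ ‖ξ₀‖ + 1 := by
      have h2 := norm_add_le ξ₀ (ξ - ξ₀)
      rw [add_sub_cancel] at h2
      have h3 : ‖ξ - ξ₀‖ < 1 := by rwa [← dist_eq_norm]
      linarith
    calc ‖pairingCLM y ξ‖ ≤ ‖pairingCLM y‖ * ‖ξ‖ := ContinuousLinearMap.le_opNorm _ _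
      _ ≤ R * (‖ξ₀‖ + 1) :=
        mul_le_mul ((norm_pairingCLM_le y).trans hy.le) h1 (norm_nonneg _) hR
  have hmeas : ∀ ξ, AEStronglyMeasurable (fun y => f y * expKernel ξ y) volume := fun ξ =>
    hf.aestronglyMeasurable.mul (continuous_expKernel ξ).aestronglyMeasurable
  refine (hasFDerivAt_integral_of_dominated_of_fderiv_le (𝕜 := ℂ)
    (F := fun ξ y => f y * expKernel ξ y)
    (F' := fun ξ y => (f y * expKernel ξ y) • (-Complex.I) • pairingCLM y)
    (bound := fun y => ‖f y‖ * Real.exp (R * (‖ξ₀‖ + 1)) * R)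
    (Metric.ball_mem_nhds ξ₀ one_pos) (Filter.Eventually.of_forall hmeas) ?_ ?_ ?_ ?_
    ?_).differentiableAt
  · refine (hf.norm.mul_const (Real.exp (R * (‖ξ₀‖ + 1)))).mono' (hmeas ξ₀)
      (Filter.Eventually.of_forall fun y => ?_)
    rw [norm_mul]
    rcases lt_or_ge ‖y‖ R with hy | hy
    · gcongr
      exact hb ξ₀ (Metric.mem_ball_self one_pos) y hy
    · rw [h0 y hy]; simp
  · exact (hmeas ξ₀).smul (continuous_pairingCLM.const_smul
      (-Complex.I)).aestronglyMeasurable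
  · refine Filter.Eventually.of_forall fun y ξ hξ => ?_
    rw [norm_smul, norm_smul, norm_mul, norm_neg, Complex.norm_I, one_mul]
    rcases lt_or_ge ‖y‖ R with hy | hy
    · gcongr
      · exact hb ξ hξ y hy
      · exact (norm_pairingCLM_le y).trans hy.le
    · rw [h0 y hy]; simp
  · exact (hf.norm.mul_const _).mul_const _
  · refine Filter.Eventually.of_forall fun y ξ _ => ?_
    have h1 : HasFDerivAt (fun ξ => expKernel ξ y)
        (expKernel ξ y • (-Complex.I) • pairingCLM y) ξ := by
      have h2 := (((pairingCLM y).hasFDerivAt (x := ξ)).const_mul (-Complex.I)).cexp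
      simp only [pairingCLM_apply] at h2
      exact h2
    have h3 := h1.const_mul (f y)
    rwa [smul_smul] at h3

/-- The exponential has modulus `e^{⟨y, Im ξ⟩}`, to which Cauchy–Schwarz applies on `‖y‖ < R`. -/
lemma norm_integral_mul_expKernel_le {n : ℕ} {f : EuclideanSpace ℝ (Fin n) → ℂ}
    (hf : Integrable f) {R : ℝ} (h0 : ∀ y, R ≤ ‖y‖ → f y = 0) (ξ : EuclideanSpace ℂ (Fin n)) :
    ‖∫ y, f y * expKernel ξ y‖ ≤ (∫ y, ‖f y‖) * Real.exp (R * ‖imPart ξ‖) := by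
  rw [← integral_mul_const]
  refine norm_integral_le_of_norm_le (hf.norm.mul_const _) (Filter.Eventually.of_forall fun y => ?_)
  rw [norm_mul]
  rcases lt_or_ge ‖y‖ R with hy | hy
  · rw [norm_expKernel]
    gcongr
    exact (sum_mul_im_le y ξ).trans (by gcongr)
  · rw [h0 y hy]; simp

end Forward

/-! ### Uniqueness of the entire extension on real points -/

section Line

variable {d : ℕ}

open scoped FourierTransform in
lemma fourier_eq_integral_expKernel {n : ℕ} (f : EuclideanSpace ℝ (Fin n) → ℂ)
    (ξ : EuclideanSpace ℝ (Fin n)) :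
    𝓕 f ξ = ∫ y, f y * expKernel (complexify ((2 * Real.pi) • ξ)) y := by
  rw [Real.fourier_eq']
  congr 1; ext y
  rw [smul_eq_mul, mul_comm, expKernel]
  congr 2
  simp only [complexify, PiLp.inner_apply, RCLike.inner_apply, conj_trivial, PiLp.smul_apply,
    smul_eq_mul]
  push_cast
  rw [Finset.mul_sum, Finset.mul_sum, Finset.sum_mul]
  refine Finset.sum_congr rfl fun j _ => ?_
  ring

open scoped FourierTransform in
lemma weinsteinTransform_eq_fourier {a : ℝ} (ha : -(1 / 2 : ℝ) < a)
    (φ : 𝓢(EuclideanSpace ℝ (Fin (d + 1)), ℂ)) (ξ : EuclideanSpace ℝ (Fin (d + 1))) :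
    weinsteinTransform a φ ξ = 𝓕 (weylTransform a φ) ((2 * Real.pi)⁻¹ • ξ) := by
  rw [fourier_eq_integral_expKernel, smul_smul, mul_inv_cancel₀ (by positivity), one_smul,
    weinsteinTransform_eq ha]

/-- All moments of the Weyl transform are finite, so its Fourier transform is smooth. -/
lemma contDiff_weinsteinTransform {a : ℝ} (ha : -(1 / 2 : ℝ) < a)
    (φ : 𝓢(EuclideanSpace ℝ (Fin (d + 1)), ℂ)) (n : ℕ) :
    ContDiff ℝ n (weinsteinTransform a φ) := by
  rw [funext (weinsteinTransform_eq_fourier ha φ)]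
  have h1 := Real.contDiff_fourier (N := n) (f := weylTransform a φ)
    (fun k _ => integrable_pow_mul_weylTransform ha φ k)
  exact h1.comp (contDiff_const_smul _)

lemma contDiff_updateLast (ξ : EuclideanSpace ℝ (Fin (d + 1))) (n : ℕ) :
    ContDiff ℝ n fun t : ℝ => updateLast ξ t := by
  rw [contDiff_euclidean]
  intro i
  refine Fin.lastCases ?_ (fun j => ?_) i
  · simp only [updateLast_last]
    exact contDiff_id
  · simpa using contDiff_const

lemma normalizedBessel_neg (a : ℝ) (z : ℂ) : normalizedBessel a (-z) = normalizedBessel a z := by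
  simp [normalizedBessel, pow_mul]

lemma weinsteinTransform_updateLast_neg (a : ℝ) (φ : EuclideanSpace ℝ (Fin (d + 1)) → ℂ)
    (ξ : EuclideanSpace ℝ (Fin (d + 1))) (t : ℝ) :
    weinsteinTransform a φ (updateLast ξ (-t)) = weinsteinTransform a φ (updateLast ξ t) := by
  unfold weinsteinTransform
  congr 1; ext x
  simp [weinsteinKernel, complexify, normalizedBessel_neg]

lemma differentiable_updateLast (ξ : EuclideanSpace ℂ (Fin (d + 1))) :
    Differentiable ℂ fun z : ℂ => updateLast ξ z := by
  rw [differentiable_euclidean]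
  intro i
  refine Fin.lastCases ?_ (fun j => ?_) i
  · simp
  · simp

lemma complexify_updateLast (ξ : EuclideanSpace ℝ (Fin (d + 1))) (t : ℝ) :
    complexify (updateLast ξ t) = updateLast (complexify ξ) (t : ℂ) :=
  ext_castSucc_last (by simp [complexify]) (by simp [complexify])

/-- An entire extension of the Weinstein transform from the half-space agrees with it on all of
`ℝ^(d+1)`. -/
lemma eq_weinsteinTransform_of_eq_on_halfSpace {a : ℝ} (ha : -(1 / 2 : ℝ) < a)
    (φ : 𝓢(EuclideanSpace ℝ (Fin (d + 1)), ℂ)) {F : EuclideanSpace ℂ (Fin (d + 1)) → ℂ}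
    (hF : Differentiable ℂ F)
    (h : ∀ ξ ∈ halfSpace d, F (complexify ξ) = weinsteinTransform a φ ξ)
    (ξ : EuclideanSpace ℝ (Fin (d + 1))) : F (complexify ξ) = weinsteinTransform a φ ξ := by
  -- Fix the first `d` coordinates and work on the complex line of the last one.
  have key := eq_of_contDiff_even_of_eq_pos (F := fun z => F (updateLast (complexify ξ) z))
    (G := fun t => weinsteinTransform a φ (updateLast ξ t))
    (hF.comp (differentiable_updateLast _))
    (fun n => (contDiff_weinsteinTransform ha φ n).comp (contDiff_updateLast ξ n))
    (weinsteinTransform_updateLast_neg a φ ξ)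
    (fun t ht => by
      rw [← complexify_updateLast]
      exact h _ (show 0 < updateLast ξ t (Fin.last d) by simpa using ht))
    (ξ (Fin.last d))
  dsimp only at key
  rwa [← complexify_updateLast, updateLast_self] at key

end Line

/-! ### Exponential type gives bounded support -/

section Backward

variable {d : ℕ}

lemma norm_gammaTwo_le (s : ℝ) : ‖gammaTwo s‖ ≤ 1 := by
  rw [gammaTwo, Complex.norm_real, norm_mul, Real.norm_of_nonneg (le_max_right _ _),
    Real.norm_of_nonneg (Real.exp_pos _).le, Real.exp_neg, ← div_eq_mul_inv,
    div_le_one (Real.exp_pos _)]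
  exact max_le (by linarith [Real.add_one_le_exp s]) (Real.exp_pos _).le

open scoped RealInnerProductSpace in
/-- An integrable function whose Fourier transform extends along every complex line in the real
direction `ω` to an entire function of exponential type `R` vanishes on `⟪y, ω⟫ > R`. -/
lemma ae_eq_zero_of_exponentialType {n : ℕ} {f : EuclideanSpace ℝ (Fin n) → ℂ}
    (hf : Integrable f) {F : EuclideanSpace ℂ (Fin n) → ℂ} (hF : Differentiable ℂ F)
    (hFf : ∀ ξ, F (complexify ξ) = ∫ y, f y * expKernel (complexify ξ) y) {R c : ℝ}
    (hc : ∀ ξ, ‖F ξ‖ ≤ c * Real.exp (R * ‖imPart ξ‖))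
    {ω : EuclideanSpace ℝ (Fin n)} (hω : ‖ω‖ = 1) :
    ∀ᵐ y, R < ⟪y, ω⟫ → f y = 0 := by
  -- The cutoff is nonzero exactly on `⟪y, ω⟫ > R`, so it suffices that `f` times it has zero
  -- Fourier transform. Writing the cutoff as an integral of `resolventSq` and using Fubini turns
  -- that transform into the contour integral.
  have hcont : Continuous fun y : EuclideanSpace ℝ (Fin n) => gammaTwo (⟪y, ω⟫ - R) :=
    continuous_gammaTwo.comp (by fun_prop)
  have hfg : Integrable fun y => f y * gammaTwo (⟪y, ω⟫ - R) :=
    hf.mul_bdd (c := 1) hcont.aestronglyMeasurable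
      (Filter.Eventually.of_forall fun y => norm_gammaTwo_le _)
  have hzero := ae_eq_zero_of_fourier_eq_zero hfg fun ξ => by
    -- Along this line the imaginary part of the argument is `2π (Im z) ω` with `ω` a unit vector,
    -- so the restriction of `F` has exponential type `2πR`.
    have hK := integral_resolventSq_mul_eq_zero
      (K := fun z => F (complexify ((2 * Real.pi) • ξ) +
        (2 * Real.pi * z) • complexify ω)) (c := c) (A := 2 * Real.pi * R)
      (hF.comp (by fun_prop)) (fun z => by
        refine (hc _).trans (le_of_eq ?_)
        have h1 : imPart (complexify ((2 * Real.pi) • ξ) + (2 * Real.pi * z) • complexify ω) =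
            (2 * Real.pi * z.im) • ω := by
          ext j
          simp [imPart, complexify]
        rw [h1, norm_smul, hω, mul_one, Real.norm_eq_abs, abs_mul,
          abs_of_pos Real.two_pi_pos]
        congr 2; ring)
    have hreal : ∀ w : ℝ, complexify ((2 * Real.pi) • ξ) +
        (2 * Real.pi * w : ℂ) • complexify ω = complexify ((2 * Real.pi) • (ξ + w • ω)) := by
      intro w; ext j
      simp [complexify]; ring
    have hexp : ∀ (w : ℝ) y, Complex.exp ((2 * Real.pi * R : ℝ) * w * Complex.I) *
        expKernel (complexify ((2 * Real.pi) • (ξ + w • ω))) y =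
        expKernel (complexify ((2 * Real.pi) • ξ)) y *
          Complex.exp (-(2 * Real.pi * (⟪y, ω⟫ - R) * w : ℝ) * Complex.I) := by
      intro w y
      rw [expKernel, expKernel, ← Complex.exp_add, ← Complex.exp_add]
      congr 1
      have h1 : ∑ j, (y j : ℂ) * complexify ((2 * Real.pi) • (ξ + w • ω)) j =
          ∑ j, (y j : ℂ) * complexify ((2 * Real.pi) • ξ) j + 2 * Real.pi * w * ⟪y, ω⟫ := by
        simp only [complexify, PiLp.inner_apply, RCLike.inner_apply, conj_trivial,
          PiLp.smul_apply, PiLp.add_apply, smul_eq_mul]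
        push_cast
        rw [Finset.mul_sum, ← Finset.sum_add_distrib]
        exact Finset.sum_congr rfl fun j _ => by ring
      rw [h1]; push_cast; ring
    simp only [hreal, hFf] at hK
    have hprod : Integrable (fun p : ℝ × EuclideanSpace ℝ (Fin n) => resolventSq p.1 *
        f p.2 * (expKernel (complexify ((2 * Real.pi) • ξ)) p.2 *
          Complex.exp (-(2 * Real.pi * (⟪p.2, ω⟫ - R) * p.1 : ℝ) * Complex.I)))
        (volume.prod volume) := by
      refine (integrable_resolventSq.mul_prod hf).mul_bdd (c := 1) ?_
        (Filter.Eventually.of_forall fun p => ?_)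
      · refine Continuous.aestronglyMeasurable ?_
        exact ((continuous_expKernel _).comp continuous_snd).mul (by fun_prop)
      · rw [norm_mul, norm_expKernel_complexify, one_mul, ← Complex.ofReal_neg,
          Complex.norm_exp_ofReal_mul_I]
    have hswap := integral_integral_swap (f := fun (w : ℝ) y => resolventSq w *
        f y * (expKernel (complexify ((2 * Real.pi) • ξ)) y *
          Complex.exp (-(2 * Real.pi * (⟪y, ω⟫ - R) * w : ℝ) * Complex.I))) hprod
    rw [fourier_eq_integral_expKernel, ← hK]
    have e1 : ∀ y, ∫ w : ℝ, resolventSq w * f y *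
        (expKernel (complexify ((2 * Real.pi) • ξ)) y *
          Complex.exp (-(2 * Real.pi * (⟪y, ω⟫ - R) * w : ℝ) * Complex.I)) =
        f y * gammaTwo (⟪y, ω⟫ - R) * expKernel (complexify ((2 * Real.pi) • ξ)) y := by
      intro y
      rw [mul_right_comm (f y), ← integral_resolventSq_mul_exp, ← integral_const_mul]
      congr 1; ext w; ring
    simp_rw [e1] at hswap
    rw [← hswap]
    congr 1; ext w
    rw [← integral_const_mul, ← integral_const_mul]
    congr 1; ext y
    rw [← hexp]; ring
  filter_upwards [hzero] with y hy hlt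
  exact (mul_eq_zero.1 hy).resolve_right (gammaTwo_ne_zero (by linarith))

/-- Near the endpoint `p - 1 > -1` and `g` is bounded; at infinity decay of order `N ≥ p + 1`
suffices. -/
lemma integrable_fracKernel_mul {g : ℝ → ℂ} (hg : Continuous g)
    (hdec : ∀ N : ℕ, ∃ D : ℝ, ∀ u > 0, u ^ N * ‖g u‖ ≤ D) {p w : ℝ} (hp : 0 < p) (hw : 0 ≤ w) :
    Integrable (fun u => (fracKernel p w u : ℂ) * g u) := by
  have h1 : (fun r => (fracKernel p w (r + w) : ℂ) * g (r + w)) =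
      (Set.Ioi (0 : ℝ)).indicator fun r => ((r ^ (p - 1) : ℝ) : ℂ) * g (r + w) := by
    ext r
    by_cases hr : 0 < r
    · rw [Set.indicator_of_mem (show r ∈ Set.Ioi (0 : ℝ) from hr), fracKernel,
        if_pos (by linarith), add_sub_cancel_right]
    · rw [Set.indicator_of_notMem (show r ∉ Set.Ioi (0 : ℝ) from hr), fracKernel,
        if_neg (by linarith)]
      simp
  suffices h : Integrable fun r => (fracKernel p w (r + w) : ℂ) * g (r + w) by
    simpa using h.comp_sub_right w
  rw [h1, integrable_indicator_iff measurableSet_Ioi,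
    ← Set.Ioc_union_Ioi_eq_Ioi (zero_le_one (α := ℝ))]
  have hmeas : Measurable fun r : ℝ => ((r ^ (p - 1) : ℝ) : ℂ) * g (r + w) :=
    (by fun_prop : Measurable fun r : ℝ => ((r ^ (p - 1) : ℝ) : ℂ)).mul
      (hg.comp (continuous_add_const w)).measurable
  refine IntegrableOn.union ?_ ?_
  · obtain ⟨D, hD⟩ := hdec 0
    have h2 : IntegrableOn (fun r : ℝ => r ^ (p - 1) * D) (Set.Ioc 0 1) := by
      have := intervalIntegral.intervalIntegrable_rpow' (a := 0) (b := 1)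
        (show -1 < p - 1 by linarith)
      rw [intervalIntegrable_iff_integrableOn_Ioc_of_le zero_le_one] at this
      exact this.mul_const D
    refine h2.mono' hmeas.aestronglyMeasurable ?_
    filter_upwards [ae_restrict_mem measurableSet_Ioc] with r hr
    rw [norm_mul, Complex.norm_real, Real.norm_of_nonneg (Real.rpow_nonneg hr.1.le _)]
    have := hD (r + w) (by linarith [hr.1])
    rw [pow_zero, one_mul] at this
    exact mul_le_mul_of_nonneg_left this (Real.rpow_nonneg hr.1.le _)
  · obtain ⟨N, hN⟩ := exists_nat_ge (p + 1)
    obtain ⟨D, hD⟩ := hdec N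
    have h2 : IntegrableOn (fun r : ℝ => r ^ (p - 1 - N) * D) (Set.Ioi 1) :=
      (integrableOn_Ioi_rpow_of_lt (show p - 1 - N < -1 by linarith) one_pos).mul_const D
    refine h2.mono' hmeas.aestronglyMeasurable ?_
    filter_upwards [ae_restrict_mem measurableSet_Ioi] with r hr
    have hr0 : 0 < r := one_pos.trans hr
    rw [norm_mul, Complex.norm_real, Real.norm_of_nonneg (Real.rpow_nonneg hr0.le _),
      Real.rpow_sub hr0 (p - 1) N, Real.rpow_natCast, div_mul_eq_mul_div, mul_div_assoc]
    refine mul_le_mul_of_nonneg_left ?_ (Real.rpow_nonneg hr0.le _)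
    rw [le_div_iff₀ (by positivity), mul_comm]
    refine le_trans ?_ (hD (r + w) (by linarith))
    gcongr
    linarith

/-- The Weyl transform is a fractional integral in the variable `u = s²`. -/
lemma weylTransform_updateLast (a : ℝ) (φ : EuclideanSpace ℝ (Fin (d + 1)) → ℂ)
    (x : EuclideanSpace ℝ (Fin (d + 1))) {t : ℝ} (ht : 0 < t) :
    weylTransform a φ (updateLast x t) = ((poissonConst a / 2 : ℝ) : ℂ) *
      fracIntegral (a + 1 / 2) (fun u => φ (updateLast x √u)) (t ^ 2) := by
  have h1 : ∀ s ∈ Set.Ioi (0 : ℝ), weylKernel a φ (swapLast d (updateLast x t, s)) =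
      ((poissonConst a / 2 : ℝ) : ℂ) * (((2 : ℝ) * s ^ ((2 : ℝ) - 1)) •
        (fun u => (fracKernel (a + 1 / 2) (t ^ 2) u : ℂ) * φ (updateLast x √u))
          (s ^ (2 : ℝ))) := by
    intro s hs
    have hs' : 0 < s := hs
    have h2 : abelKernel a s t = fracKernel (a + 1 / 2) (t ^ 2) (s ^ 2) := by
      rw [abelKernel, fracKernel, abs_of_pos ht, show a + 1 / 2 - 1 = a - 1 / 2 by ring]
      simp only [sq_lt_sq₀ ht.le hs'.le]
    rw [weylKernel_swapLast, updateLast_last, updateLast_updateLast, h2, Real.rpow_two,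
      show (2 : ℝ) - 1 = 1 by norm_num, Real.rpow_one, Complex.real_smul]
    dsimp only
    rw [Real.sqrt_sq hs'.le]
    push_cast; ring
  have h3 : weylTransform a φ (updateLast x t) =
      ∫ s in Set.Ioi (0 : ℝ), weylKernel a φ (swapLast d (updateLast x t, s)) := by
    rw [weylTransform, setIntegral_eq_integral_of_forall_compl_eq_zero]
    intro s hs
    rw [weylKernel_swapLast, abelKernel_of_le ((not_lt.1 hs).trans (abs_nonneg _))]
    simp
  rw [h3, setIntegral_congr_fun measurableSet_Ioi h1, integral_const_mul,
    integral_comp_rpow_Ioi_of_pos (g := fun u =>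
      (fracKernel (a + 1 / 2) (t ^ 2) u : ℂ) * φ (updateLast x √u)) two_pos, fracIntegral,
    setIntegral_eq_integral_of_forall_compl_eq_zero]
  intro u hu
  rw [fracKernel, if_neg]
  · simp
  · have : u ≤ 0 := not_lt.1 hu
    nlinarith [sq_nonneg t]

/-- Squaring is differentiable, so it maps null sets to null sets. -/
lemma ae_sq_of_ae {P : ℝ → Prop} {t₀ : ℝ} (h : ∀ᵐ t, t₀ < t → P (t ^ 2)) :
    ∀ᵐ v, t₀ ^ 2 < v → P v := by
  rw [ae_iff] at h ⊢
  push Not at h ⊢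
  have h1 := addHaar_image_eq_zero_of_differentiableOn_of_addHaar_eq_zero volume
    (f := fun t : ℝ => t ^ 2) (by fun_prop) h
  refine measure_mono_null ?_ h1
  rintro v ⟨hv, hP⟩
  have hv0 : 0 ≤ v := (sq_nonneg t₀).trans hv.le
  refine ⟨√v, ⟨Real.lt_sqrt_of_sq_lt hv, ?_⟩, Real.sq_sqrt hv0⟩
  rwa [Real.sq_sqrt hv0]

lemma updateLast_sqrt_decay (φ : 𝓢(EuclideanSpace ℝ (Fin (d + 1)), ℂ))
    (x : EuclideanSpace ℝ (Fin (d + 1))) (N : ℕ) :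
    ∃ D : ℝ, ∀ u > 0, u ^ N * ‖φ (updateLast x √u)‖ ≤ D := by
  -- The order is doubled because `u` is the square of the last coordinate.
  obtain ⟨D, -, hD⟩ := φ.decay (2 * N) 0
  refine ⟨D, fun u hu => le_trans ?_ (hD (updateLast x √u))⟩
  rw [norm_iteratedFDeriv_zero, pow_mul]
  gcongr
  have h1 := last_le_norm (updateLast x √u)
  rw [updateLast_last] at h1
  calc u = √u ^ 2 := (Real.sq_sqrt hu.le).symm
    _ ≤ _ := by gcongr

/-- Injectivity of the Weyl transform on vertical half-lines. -/
lemma eq_zero_of_weylTransform_eq_zero {a : ℝ} (ha : -(1 / 2 : ℝ) < a)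
    (φ : 𝓢(EuclideanSpace ℝ (Fin (d + 1)), ℂ)) (x : EuclideanSpace ℝ (Fin (d + 1))) {t₀ : ℝ}
    (ht₀ : 0 ≤ t₀) (h : ∀ᵐ t, t₀ < t → weylTransform a φ (updateLast x t) = 0) {s : ℝ}
    (hs : t₀ < s) : φ (updateLast x s) = 0 := by
  have hgc : Continuous fun u : ℝ => φ (updateLast x √u) :=
    φ.continuous.comp (continuous_updateLast.comp (continuous_const.prodMk Real.continuous_sqrt))
  have hC : ((poissonConst a / 2 : ℝ) : ℂ) ≠ 0 := by
    exact_mod_cast (half_pos (poissonConst_pos ha)).ne'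
  have h1 := ae_eq_zero_of_fracIntegral_eq_zero (b := a + 1 / 2) (v₀ := t₀ ^ 2) (by linarith)
    hgc.measurable
    (fun p hp w hw => integrable_fracKernel_mul hgc (updateLast_sqrt_decay φ x) hp
      ((sq_nonneg t₀).trans hw))
    (ae_sq_of_ae (by
      filter_upwards [h] with t ht hlt
      have h2 := ht hlt
      rw [weylTransform_updateLast a φ x (ht₀.trans_lt hlt)] at h2
      exact (mul_eq_zero.1 h2).resolve_left hC))
  have h3 : (fun u : ℝ => φ (updateLast x √u)) =ᵐ[volume.restrict (Set.Ioi (t₀ ^ 2))]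
      fun _ => 0 := by
    rw [Filter.EventuallyEq, ae_restrict_iff' measurableSet_Ioi]
    exact h1
  have h4 := Measure.eqOn_open_of_ae_eq h3 isOpen_Ioi hgc.continuousOn continuousOn_const
    (show s ^ 2 ∈ Set.Ioi (t₀ ^ 2) from (sq_lt_sq₀ ht₀ (ht₀.trans hs.le)).2 hs)
  simpa [Real.sqrt_sq (ht₀.trans hs.le)] using h4

open scoped RealInnerProductSpace in
lemma inner_updateLast (x ω : EuclideanSpace ℝ (Fin (d + 1))) (t : ℝ) :
    ⟪updateLast x t, ω⟫ = ⟪x, ω⟫ + (t - x (Fin.last d)) * ω (Fin.last d) := by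
  simp [PiLp.inner_apply, Fin.sum_univ_castSucc]
  ring

-- Since `ω` points upward, the half-space `⟪y, ω⟫ > R` contains the vertical half-line above each
-- of its points. Fubini makes the Weyl transform vanish almost everywhere on almost every such
-- half-line, injectivity there gives `φ = 0` almost everywhere, and continuity removes the
-- exception.
open scoped RealInnerProductSpace in
lemma eq_zero_of_weylTransform_ae_eq_zero {a : ℝ} (ha : -(1 / 2 : ℝ) < a)
    (φ : 𝓢(EuclideanSpace ℝ (Fin (d + 1)), ℂ)) {R : ℝ} {ω : EuclideanSpace ℝ (Fin (d + 1))}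
    (hω : 0 < ω (Fin.last d)) (h : ∀ᵐ y, R < ⟪y, ω⟫ → weylTransform a φ y = 0)
    {x : EuclideanSpace ℝ (Fin (d + 1))} (hx : 0 < x (Fin.last d)) (hxR : R < ⟪x, ω⟫) :
    φ x = 0 := by
  have h1 : ∀ᵐ p : EuclideanSpace ℝ (Fin (d + 1)) × ℝ ∂(volume.prod volume),
      R < ⟪p.1, ω⟫ → weylTransform a φ p.1 = 0 :=
    Measure.quasiMeasurePreserving_fst.ae h
  have h2 := Measure.ae_ae_of_ae_prod (measurePreserving_swapLast.quasiMeasurePreserving.ae h1)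
  simp only [swapLast_apply] at h2
  set U : Set (EuclideanSpace ℝ (Fin (d + 1))) := {x | 0 < x (Fin.last d) ∧ R < ⟪x, ω⟫} with hU
  have hUo : IsOpen U :=
    (isOpen_lt (f := fun _ => (0 : ℝ)) (g := fun x : EuclideanSpace ℝ (Fin (d + 1)) =>
      x (Fin.last d)) continuous_const (by fun_prop)).inter
      (isOpen_lt (f := fun _ => R) (g := fun x => ⟪x, ω⟫) continuous_const (by fun_prop))
  have h3 : φ =ᵐ[volume.restrict U] fun _ => 0 := by
    rw [Filter.EventuallyEq, ae_restrict_iff' hUo.measurableSet]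
    filter_upwards [h2] with x hx hxU
    have hq : 0 < (⟪x, ω⟫ - R) / ω (Fin.last d) := div_pos (by linarith [hxU.2]) hω
    -- The second entry of the maximum is the height at which the vertical line through `x` crosses
    -- `⟪y, ω⟫ = R`.
    have h4 := eq_zero_of_weylTransform_eq_zero ha φ x
      (t₀ := max 0 (x (Fin.last d) - (⟪x, ω⟫ - R) / ω (Fin.last d))) (le_max_left _ _) (by
        filter_upwards [hx] with t ht hlt
        refine ht ?_
        have h5 := (max_lt_iff.1 hlt).2
        rw [sub_lt_comm, lt_div_iff₀ hω] at h5
        rw [inner_updateLast]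
        linarith) (max_lt hxU.1 (by linarith))
    rwa [updateLast_self] at h4
  exact Measure.eqOn_open_of_ae_eq h3 hUo φ.continuous.continuousOn continuousOn_const ⟨hx, hxR⟩

lemma updateLast_neg_eq_reflectLast (x : EuclideanSpace ℝ (Fin (d + 1))) :
    updateLast x (-x (Fin.last d)) = reflectLast x := rfl

/-- By evenness and continuity it suffices to prove vanishing in the open upper half-space. -/
lemma eq_zero_of_forall_halfSpace {φ : 𝓢(EuclideanSpace ℝ (Fin (d + 1)), ℂ)}
    (hφ : φ ∈ EvenSchwartz d) {R : ℝ}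
    (h : ∀ x, 0 < x (Fin.last d) → R < ‖x‖ → φ x = 0) (x : EuclideanSpace ℝ (Fin (d + 1)))
    (hx : R ≤ ‖x‖) : φ x = 0 := by
  have key : ∀ x : EuclideanSpace ℝ (Fin (d + 1)), 0 ≤ x (Fin.last d) → R ≤ ‖x‖ → φ x = 0 := by
    intro x hx0 hx
    have hc : Continuous fun t : ℝ => φ (updateLast x t) :=
      φ.continuous.comp (continuous_updateLast.comp (continuous_const.prodMk continuous_id))
    have h1 : Filter.Tendsto (fun t : ℝ => φ (updateLast x t))
        (nhdsWithin (x (Fin.last d)) (Set.Ioi (x (Fin.last d))))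
        (nhds (φ (updateLast x (x (Fin.last d))))) :=
      hc.continuousAt.tendsto.mono_left nhdsWithin_le_nhds
    rw [updateLast_self] at h1
    refine tendsto_nhds_unique h1 (tendsto_const_nhds.congr' ?_)
    filter_upwards [self_mem_nhdsWithin] with t ht
    have ht' : x (Fin.last d) < t := ht
    refine (h _ (by simpa using hx0.trans_lt ht') (hx.trans_lt ?_)).symm
    have h2 := norm_updateLast_sq x t
    exact lt_of_pow_lt_pow_left₀ 2 (norm_nonneg _) (by nlinarith)
  rcases le_or_gt 0 (x (Fin.last d)) with h0 | h0
  · exact key x h0 hx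
  · have h1 : φ (reflectLast x) = φ x := hφ x
    rw [← h1, ← updateLast_neg_eq_reflectLast]
    refine key _ (by rw [updateLast_last]; linarith) (hx.trans (norm_le_norm_updateLast ?_))
    rw [abs_neg]

end Backward

/-! ### The Paley–Wiener theorem -/

theorem mainTheorem1 (d : ℕ) (hd : 1 ≤ d) (α : ℝ) (hα : -(1 / 2 : ℝ) < α)
    (R : ℝ) (hR : 0 < R)
    (φ : 𝓢(EuclideanSpace ℝ (Fin (d + 1)), ℂ)) (hφ : φ ∈ EvenSchwartz d) :
    Function.support φ ⊆ Metric.ball 0 R ↔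
      ∃ F : EuclideanSpace ℂ (Fin (d + 1)) → ℂ,
        Differentiable ℂ F ∧
        (∀ ξ ∈ halfSpace d, F (complexify ξ) = weinsteinTransform α φ ξ) ∧
        ∃ c : ℝ, ∀ y : EuclideanSpace ℂ (Fin (d + 1)),
          ‖F y‖ ≤ c * Real.exp (R * ‖imPart y‖) := by
  rw [support_subset_ball_iff]
  have hf := integrable_weylTransform hα φ
  constructor
  · intro h
    have h0 : ∀ y, R ≤ ‖y‖ → weylTransform α φ y = 0 := fun y hy => weylTransform_eq_zero h hy
    exact ⟨fun ξ => ∫ y, weylTransform α φ y * expKernel ξ y,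
      differentiable_integral_mul_expKernel hf hR.le h0,
      fun ξ _ => (weinsteinTransform_eq hα φ ξ).symm,
      ∫ y, ‖weylTransform α φ y‖, norm_integral_mul_expKernel_le hf h0⟩
  · rintro ⟨F, hF, hFφ, c, hc⟩
    refine eq_zero_of_forall_halfSpace hφ fun x hx hxR => ?_
    have hx0 : 0 < ‖x‖ := hR.trans hxR
    -- The direction of `x` itself is enough: `ω` points upward because `x` does, and `⟪x, ω⟫ = ‖x‖
    -- > R`.
    have hae := ae_eq_zero_of_exponentialType hf hF (fun ξ => by
      rw [eq_weinsteinTransform_of_eq_on_halfSpace hα φ hF hFφ, weinsteinTransform_eq hα]) hc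
      (ω := ‖x‖⁻¹ • x) (by rw [norm_smul, norm_inv, norm_norm, inv_mul_cancel₀ hx0.ne'])
    refine eq_zero_of_weylTransform_ae_eq_zero hα φ ?_ hae hx ?_
    · rw [PiLp.smul_apply, smul_eq_mul]
      positivity
    · rw [real_inner_smul_right, real_inner_self_eq_norm_sq, sq, inv_mul_cancel_left₀ hx0.ne']
      exact hxR
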